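/- Let $S=\mathbb Z$ or $S=\mathbb N=\{1,2,3,\dots\}$. For a function $V:S\to\mathbb R$ let $H_V$ be the self-adjoint operator in $\ell^2(S)$ given by $(H_V\psi)(n)=\psi(n-1)+\psi(n+1)+V(n)\psi(n)$ on its maximal domain, with the Dirichlet condition $\psi(0)=0$ if $S=\mathbb N$. Let $A(n,z)=\begin{pmatrix} z-V(n) & -1\\ 1 & 0\end{pmatrix}$, and let $T_V(n,m;z)=A(n,z)A(n-1,z)\cdots A(m+1,z)$ for $n>m$, $T_V(n,n;z)=I$, and $T_V(n,m;z)=T_V(m,n;z)^{-1}$ for $n<m$. With $\psi(t)=e^{-itH_V}\delta_1$ put, for $T>0$, $p>0$, $$a_V(n,T)=\frac1T\int_0^\infty e^{-2t/T}|\psi(t,n)|^2\,dt,\qquad \langle |X|^p\rangle_V(T)=\sum_{n\in S}|n|^p a_V(n,T),\qquad \beta_V^-(p)=\liminf_{T\to\infty}\frac{\log\langle |X|^p\rangle_V(T)}{\log T}.$$ Let $V_0:S\to\mathbb R$, let $W:S\to\mathbb R$ be finitely supported, and let $V=V_0+W$, so that $H_V=H_{V_0}+W$. (1) Let $K,C,\alpha>0$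 and let $A(N)\subset\mathbb R$, $N>0$, be sets such that for all $N$ large enough, $A(N)$ is a nonempty Borel subset of $[-K,K]$ and $\|T_{V_0}(n,m;E)\|\le CN^{\alpha}$ for all $E\in A(N)$ and all $n,m\in S$ with $|n|\le N$, $|m|\le N$. Let $N(T)=T^{1/(1+\alpha)}$ and $B(T)=\{E\in\mathbb R:\exists E'\in A(N(T)),\ |E-E'|\le 1/T\}$. Then there is $T_0>1$ such that the following holds. There is a constant $\hat C>0$ with $$\sum_{n\in S,\ |n|\ge N(T)/2}a_V(n,T)\ \ge\ \frac{\hat C}{T}\,|B(T)|\,N(T)^{1-2\alpha}\qquad\text{for all }T\ge T_0,$$ and for every $p>0$ there is a constant $\hat C_p>0$ with $$\langle |X|^p\rangle_V(T)\ \ge\ \frac{\hat C_p}{T}\,|B(T)|\,N(T)^{p+1-2\alpha}\qquad\text{for all }T\ge T_0.$$ Here $|B|$ is the Lebesgue measure of $B$. (2) If for some $E_0\in\mathbb R$, $C$ and $\alpha\ge0$ one has $\|T_{V_0}(n,m;E_0)\|\le C(|n|+|m|)^{\alpha}$ for all $n,m\in S$ with $(n,m)\ne(0,0)$, then $\beta_V^-(p)\ge\frac{p-1-4\alpha}{1+\alpha}$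 for every $p>0$. (3) If for some $C>0$, $E_0\in\mathbb R$ and $\theta\ge1$ one has $\|T_{V_0}(n,1;E)\|\le C$ for all $n\in S\setminus\{0\}$ and $E\in\mathbb R$ with $|n|\cdot|E-E_0|^{\theta}\le1$, then $\beta_V^-(p)\ge p-\frac1\theta$ for every $p>0$. -/

import Mathlib

open MeasureTheory Filter Topology
open scoped ENNReal Matrix.Norms.L2Operator

namespace Schrodinger

/-- The Hilbert space `ℓ²(S)` for a set `S ⊆ ℤ` of sites. The whole line is `S = ℤ`, the half line
`ℕ = {1, 2, …}` is `S = [1, ∞)`. -/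
noncomputable abbrev L2 (S : Set ℤ) := lp (fun _ : S => ℂ) 2

open Classical in
/-- Extension of a function on `S` to `ℤ` by zero; on the half line this is the Dirichlet condition
`u 0 = 0`. -/
noncomputable def zeroExt {S : Set ℤ} {R : Type} [Zero R] (u : S → R) (k : ℤ) : R :=
  if h : k ∈ S then u ⟨k, h⟩ else 0

/-- The formal action `(Hu)(n) = u(n-1) + u(n+1) + V(n) u(n)`, with `u = 0` outside `S`. -/
noncomputable def formalH {S : Set ℤ} (V : S → ℝ) (u : S → ℂ) (n : S) : ℂ :=
  zeroExt u (n - 1) + zeroExt u (n + 1) + V n * u n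

section aux
variable {S : Set ℤ}

theorem zeroExt_coe {R : Type} [Zero R] (u : S → R) (n : S) : zeroExt u n = u n := by
  simp [zeroExt]

theorem zeroExt_add (u v : S → ℂ) (k : ℤ) : zeroExt (u + v) k = zeroExt u k + zeroExt v k := by
  by_cases hk : k ∈ S <;> simp [zeroExt, hk]

theorem zeroExt_smul (c : ℂ) (u : S → ℂ) (k : ℤ) : zeroExt (c • u) k = c * zeroExt u k := by
  by_cases hk : k ∈ S <;> simp [zeroExt, hk]

theorem zeroExt_of_notMem {R : Type} [Zero R] (u : S → R) {k : ℤ} (hk : k ∉ S) :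
    zeroExt u k = 0 := by simp [zeroExt, hk]

theorem hasSum_zeroExt (u : L2 S) : HasSum (fun k : ℤ => ‖zeroExt u k‖ ^ 2) (‖u‖ ^ 2) := by
  have h := lp.hasSum_norm (p := 2) (by norm_num) u
  simp only [ENNReal.toReal_ofNat, Real.rpow_ofNat] at h
  rw [← Subtype.val_injective.hasSum_iff (f := fun k : ℤ => ‖zeroExt u k‖ ^ 2)]
  · convert! h using 2 with n
    simp [zeroExt_coe]
  · intro k hk
    rw [zeroExt_of_notMem]
    · simp
    · intro h; exact hk ⟨⟨k, h⟩, rfl⟩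

/-- The shift by `j` with zero boundary conditions outside `S`. -/
noncomputable def shift (S : Set ℤ) (j : ℤ) : L2 S →L[ℂ] L2 S :=
  have key (u : L2 S) (s : Finset S) : ∑ n ∈ s, ‖zeroExt u (n + j)‖ ^ 2 ≤ ‖u‖ ^ 2 := by
    have hinj : Function.Injective (fun n : S => (n : ℤ) + j) := fun a b h => by
      simpa [Subtype.ext_iff] using h
    calc _ = ∑ k ∈ s.map ⟨_, hinj⟩, ‖zeroExt u k‖ ^ 2 := by simp
      _ ≤ _ := sum_le_hasSum _ (fun _ _ => by positivity) (hasSum_zeroExt u)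
  LinearMap.mkContinuous
    { toFun := fun u => ⟨fun n => zeroExt u (n + j), by
        refine memℓp_gen' (C := ‖u‖ ^ 2) fun s => ?_
        simpa using key u s⟩
      map_add' := fun u v => by ext n; exact zeroExt_add _ _ _
      map_smul' := fun c u => by ext n; exact zeroExt_smul _ _ _ } 1 fun u => by
    refine lp.norm_le_of_forall_sum_le (by norm_num) (by positivity) fun s => ?_
    simpa using key u s

theorem shift_apply (j : ℤ) (u : L2 S) (n : S) : shift S j u n = zeroExt u (n + j) := rfl

theorem inner_shift (j : ℤ) (u v : L2 S) :
    inner ℂ (shift S j u) v = inner ℂ u (shift S (-j) v) := by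
  have h1 : inner ℂ (shift S j u) v =
      ∑' k : ℤ, inner ℂ (zeroExt u (k + j)) (zeroExt v k) := by
    rw [lp.inner_eq_tsum, ← (Subtype.val_injective (p := (· ∈ S))).tsum_eq
      (f := fun k : ℤ => inner ℂ (zeroExt u (k + j)) (zeroExt v k))]
    · simp only [zeroExt_coe, shift_apply]
    · intro k hk
      by_contra h
      refine hk ?_
      simp only
      rw [zeroExt_of_notMem v (k := k) (fun hs => h ⟨⟨k, hs⟩, rfl⟩), inner_zero_right]
  have h2 : inner ℂ u (shift S (-j) v) =
      ∑' k : ℤ, inner ℂ (zeroExt u k) (zeroExt v (k + -j)) := by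
    rw [lp.inner_eq_tsum, ← (Subtype.val_injective (p := (· ∈ S))).tsum_eq
      (f := fun k : ℤ => inner ℂ (zeroExt u k) (zeroExt v (k + -j)))]
    · simp only [zeroExt_coe, shift_apply]
    · intro k hk
      by_contra h
      refine hk ?_
      simp only
      rw [zeroExt_of_notMem u (k := k) (fun hs => h ⟨⟨k, hs⟩, rfl⟩), inner_zero_left]
  rw [h1, h2, ← (Equiv.addRight j).tsum_eq
    (fun k : ℤ => inner ℂ (zeroExt u k) (zeroExt v (k + -j)))]
  simp

/-- The hopping part of the operator. -/
noncomputable def hop (S : Set ℤ) : L2 S →L[ℂ] L2 S := shift S (-1) + shift S 1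

theorem hop_apply (u : L2 S) (n : S) : hop S u n = zeroExt u (n - 1) + zeroExt u (n + 1) := rfl

theorem inner_hop (u v : L2 S) : inner ℂ (hop S u) v = inner ℂ u (hop S v) := by
  rw [hop, add_apply, add_apply, inner_add_left, inner_add_right, inner_shift, inner_shift, neg_neg,
    add_comm]

end aux

theorem formalH_add {S : Set ℤ} (V : S → ℝ) (u v : S → ℂ) :
    formalH V (u + v) = formalH V u + formalH V v := by
  ext n
  simp only [formalH, zeroExt_add, Pi.add_apply]
  ring

theorem formalH_smul {S : Set ℤ} (V : S → ℝ) (c : ℂ) (u : S → ℂ) :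
    formalH V (c • u) = c • formalH V u := by
  ext n
  simp only [formalH, zeroExt_smul, Pi.smul_apply, smul_eq_mul]
  ring

/-- The Schrödinger operator `H` with real potential `V` in `ℓ²(S)`, on its natural (maximal) domain
`{u ∈ ℓ²(S) | Hu ∈ ℓ²(S)}`. The potential may be unbounded. On this domain `H` is self-adjoint. -/
noncomputable def hamiltonian {S : Set ℤ} (V : S → ℝ) : L2 S →ₗ.[ℂ] L2 S where
  domain :=
    { carrier := {u | Memℓp (formalH V u) 2}
      add_mem' := fun {u v} hu hv => by
        change Memℓp (formalH V ((u : S → ℂ) + v)) 2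
        rw [formalH_add]
        exact Memℓp.add hu hv
      zero_mem' := by
        have h : formalH V (0 : S → ℂ) = 0 := by simpa using formalH_smul V 0 0
        change Memℓp (formalH V (0 : S → ℂ)) 2
        rw [h]
        exact zero_memℓp
      smul_mem' := fun c u hu => by
        change Memℓp (formalH V (c • (u : S → ℂ))) 2
        rw [formalH_smul]
        exact Memℓp.const_smul hu c }
  toFun :=
    { toFun := fun u => ⟨formalH V u, u.2⟩
      map_add' := fun u v => Subtype.ext (formalH_add V u v)
      map_smul' := fun c u => Subtype.ext (formalH_smul V c u) }

section
variable {S : Set ℤ}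

theorem hamiltonian_apply (V : S → ℝ) (u : (hamiltonian V).domain) (n : S) :
    hamiltonian V u n = hop S u n + V n * (u : L2 S) n := rfl

theorem mem_domain {V : S → ℝ} {u : L2 S} (f : L2 S)
    (h : ∀ n, f n = hop S u n + V n * u n) : u ∈ (hamiltonian V).domain := by
  change Memℓp (formalH V u) 2
  have : formalH V u = f := funext fun n => (h n).symm
  rw [this]; exact lp.memℓp f

theorem inner_hamiltonian (V : S → ℝ) (u v : (hamiltonian V).domain) :
    inner ℂ (hamiltonian V u) (v : L2 S) = inner ℂ (u : L2 S) (hamiltonian V v) := by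
  have h1 := (lp.hasSum_inner (𝕜 := ℂ) (hamiltonian V u) (v : L2 S)).sub
    (lp.hasSum_inner (𝕜 := ℂ) (hop S u) (v : L2 S))
  have h2 := (lp.hasSum_inner (𝕜 := ℂ) (u : L2 S) (hamiltonian V v)).sub
    (lp.hasSum_inner (𝕜 := ℂ) (u : L2 S) (hop S v))
  have h3 := h1.unique (by
    convert! h2 using 2 with n
    simp only [hamiltonian_apply, RCLike.inner_apply, map_add, map_mul, Complex.conj_ofReal]
    ring)
  rw [inner_hop] at h3
  linear_combination h3

/-- `ψ` solves the Schrödinger equation `i ψ'(t) = H ψ(t)`, `ψ(0) = φ`, for all real times: `ψ(t)`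
lies in the domain of `H` and the derivative is taken in the norm of `ℓ²(S)`. -/
def IsSchrodingerSolution (V : S → ℝ) (φ : L2 S) (ψ : ℝ → L2 S) : Prop :=
  ψ 0 = φ ∧ ∀ t, ∃ h : ψ t ∈ (hamiltonian V).domain,
    HasDerivAt ψ (-Complex.I • hamiltonian V ⟨ψ t, h⟩) t

theorem IsSchrodingerSolution.norm_eq {V : S → ℝ} {φ : L2 S} {ψ : ℝ → L2 S}
    (h : IsSchrodingerSolution V φ ψ) (t : ℝ) : ‖ψ t‖ = ‖φ‖ := by
  have hd (s : ℝ) : HasDerivAt (fun r => (inner ℂ (ψ r) (ψ r) : ℂ)) 0 s := by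
    obtain ⟨hs, hds⟩ := h.2 s
    convert! hds.inner ℂ hds using 1
    have := inner_hamiltonian V ⟨ψ s, hs⟩ ⟨ψ s, hs⟩
    simp only [inner_smul_left, inner_smul_right, map_neg, Complex.conj_I] at this ⊢
    rw [this]; ring
  have := is_const_of_deriv_eq_zero (fun s => (hd s).differentiableAt) (fun s => (hd s).deriv) t 0
  simp only [h.1, inner_self_eq_norm_sq_to_K] at this
  have h2 : ‖ψ t‖ ^ 2 = ‖φ‖ ^ 2 := by exact_mod_cast this
  exact (pow_left_inj₀ (norm_nonneg _) (norm_nonneg _) two_ne_zero).1 h2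

theorem IsSchrodingerSolution.unique {V : S → ℝ} {φ : L2 S} {ψ χ : ℝ → L2 S}
    (h : IsSchrodingerSolution V φ ψ) (h' : IsSchrodingerSolution V φ χ) : ψ = χ := by
  have hs : IsSchrodingerSolution V 0 (ψ - χ) := by
    refine ⟨by simp [h.1, h'.1], fun t => ?_⟩
    obtain ⟨m, d⟩ := h.2 t
    obtain ⟨m', d'⟩ := h'.2 t
    refine ⟨Submodule.sub_mem _ m m', ?_⟩
    convert! d.sub d' using 1
    rw [← smul_sub, ← LinearPMap.map_sub]
    rfl
  ext1 t
  have := hs.norm_eq t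
  rw [norm_zero, norm_eq_zero] at this
  exact sub_eq_zero.1 this

/-- Multiplication by `exp (i t V)`. -/
noncomputable def phase (V : S → ℝ) (t : ℝ) : L2 S →L[ℂ] L2 S :=
  LinearMap.mkContinuous
    { toFun := fun u => ⟨fun n => Complex.exp (t * V n * Complex.I) * u n, by
        refine memℓp_gen' (C := ‖u‖ ^ 2) fun s => ?_
        have := lp.sum_rpow_le_norm_rpow (p := 2) (by norm_num) u s
        have he (n : S) := Complex.norm_exp_ofReal_mul_I (t * V n)
        push_cast at he
        simpa [he] using this⟩
      map_add' := fun u v => by ext n; exact mul_add _ _ _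
      map_smul' := fun c u => by ext n; simp; ring } 1 fun u => by
    refine lp.norm_le_of_forall_sum_le (by norm_num) (by positivity) fun s => ?_
    have := lp.sum_rpow_le_norm_rpow (p := 2) (by norm_num) u s
    have he (n : S) := Complex.norm_exp_ofReal_mul_I (t * V n)
    push_cast at he
    simpa [he] using this

theorem phase_apply (V : S → ℝ) (t : ℝ) (u : L2 S) (n : S) :
    phase V t u n = Complex.exp (t * V n * Complex.I) * u n := rfl

theorem norm_phase_le (V : S → ℝ) (t : ℝ) (u : L2 S) : ‖phase V t u‖ ≤ ‖u‖ := by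
  have := (LinearMap.mkContinuous_norm_le _ zero_le_one _ : ‖phase V t‖ ≤ 1)
  exact (phase V t).le_of_opNorm_le this u |>.trans_eq (one_mul _)

theorem continuous_phase_left (V : S → ℝ) (u : L2 S) : Continuous fun t => phase V t u := by
  classical
  have hs := lp.hasSum_single (by norm_num) u
  have : TendstoUniformly (fun (s : Finset S) t => phase V t (∑ n ∈ s, lp.single 2 n (u n)))
      (fun t => phase V t u) atTop := by
    rw [Metric.tendstoUniformly_iff]
    intro ε hε
    filter_upwards [(Metric.tendsto_nhds.1 hs) ε hε] with s hs t
    rw [dist_eq_norm, ← map_sub]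
    refine (norm_phase_le _ _ _).trans_lt ?_
    rwa [dist_comm, dist_eq_norm] at hs
  refine this.continuous (Eventually.of_forall fun s => ?_).frequently
  simp only [map_sum]
  refine continuous_finsetSum _ fun n _ => ?_
  have : (fun t => phase V t (lp.single 2 n (u n))) =
      fun t : ℝ => lp.single 2 n (Complex.exp (t * V n * Complex.I) * u n) := by
    ext t m
    rw [phase_apply]
    by_cases hm : m = n
    · subst hm; simp
    · simp [lp.single_apply, hm]
  rw [this]
  exact (lp.isometry_single (E := fun _ : S => ℂ) (p := 2) n).continuous.comp (by fun_prop)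

theorem continuous_phase {X : Type} [TopologicalSpace X] (V : S → ℝ) {f : X → ℝ} {u : X → L2 S}
    (hf : Continuous f) (hu : Continuous u) : Continuous fun x => phase V (f x) (u x) := by
  rw [continuous_iff_continuousAt]
  intro x
  rw [ContinuousAt, tendsto_iff_norm_sub_tendsto_zero]
  have h1 : Tendsto (fun y => ‖u y - u x‖ + ‖phase V (f y) (u x) - phase V (f x) (u x)‖)
      (𝓝 x) (𝓝 0) := by
    have a := (tendsto_iff_norm_sub_tendsto_zero.1 (hu.tendsto x))
    have b := tendsto_iff_norm_sub_tendsto_zero.1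
      (((continuous_phase_left V (u x)).comp hf).tendsto x)
    simpa using a.add b
  refine squeeze_zero (fun _ => norm_nonneg _) (fun y => ?_) h1
  calc _ = ‖phase V (f y) (u y - u x) + (phase V (f y) (u x) - phase V (f x) (u x))‖ := by
        rw [map_sub]; congr 1; abel
    _ ≤ _ := (norm_add_le _ _).trans (by gcongr; exact norm_phase_le _ _ _)

/-- The terms of the Dyson series of the equation `χ' = F χ`, `χ(0) = x`. -/
noncomputable def dyson {E : Type} [NormedAddCommGroup E] [NormedSpace ℝ E] (F : ℝ → E → E) (x : E) : ℕ → ℝ → E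
  | 0 => fun _ => x
  | k + 1 => fun t => ∫ s in (0 : ℝ)..t, F s (dyson F x k s)

theorem exists_linear_ode {E : Type} [NormedAddCommGroup E] [NormedSpace ℝ E] [CompleteSpace E] (F : ℝ → E →L[ℝ] E) (c : ℝ) (hc : 0 ≤ c)
    (hF : ∀ t u, ‖F t u‖ ≤ c * ‖u‖)
    (hcont : ∀ u : ℝ → E, Continuous u → Continuous fun t => F t (u t)) (x : E) :
    ∃ χ : ℝ → E, χ 0 = x ∧ ∀ t, HasDerivAt χ (F t (χ t)) t := by
  set g := dyson (fun t => F t) x with hg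
  have gsucc (k : ℕ) (t : ℝ) : g (k + 1) t = ∫ s in (0 : ℝ)..t, F s (g k s) := rfl
  have hgc (k : ℕ) : Continuous (g k) := by
    induction k with
    | zero => exact continuous_const
    | succ k ih =>
      exact intervalIntegral.continuous_primitive
        (fun a b => (hcont _ ih).intervalIntegrable a b) 0
  have hgd (k : ℕ) (t : ℝ) : HasDerivAt (g (k + 1)) (F t (g k t)) t :=
    intervalIntegral.integral_hasDerivAt_right ((hcont _ (hgc k)).intervalIntegrable _ _)
      ((hcont _ (hgc k)).stronglyMeasurableAtFilter _ _) (hcont _ (hgc k)).continuousAt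
  have hgb (k : ℕ) (t : ℝ) : ‖g k t‖ ≤ (c * |t|) ^ k / k.factorial * ‖x‖ := by
    induction k generalizing t with
    | zero => simp [hg, dyson]
    | succ k ih =>
      rw [gsucc]
      have h1 : ∀ s, ‖F s (g k s)‖ ≤ c ^ (k + 1) / k.factorial * ‖x‖ * |s - 0| ^ k := fun s => by
        refine (hF _ _).trans ((mul_le_mul_of_nonneg_left (ih s) hc).trans_eq ?_)
        rw [sub_zero]; ring
      refine (intervalIntegral.norm_integral_le_abs_of_norm_le (μ := volume)
        (ae_of_all _ fun s => h1 s) (Continuous.intervalIntegrable (by fun_prop) _ _)).trans_eq ?_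
      rw [intervalIntegral.integral_const_mul, abs_mul, intervalIntegral.abs_intervalIntegral_eq,
        integral_pow_abs_sub_uIoc, Nat.factorial_succ, abs_of_nonneg (by positivity),
        abs_of_nonneg (by positivity)]
      push_cast
      rw [sub_zero, mul_pow]
      field_simp
  have hsum (M : ℝ) : Summable fun k : ℕ => (c * M) ^ k / k.factorial * ‖x‖ :=
    (Real.summable_pow_div_factorial _).mul_right _
  have hsg (t : ℝ) : Summable fun k => g k t := .of_norm_bounded (hsum |t|) fun k => hgb k t
  refine ⟨fun t => ∑' k, g k t, ?_, fun t => ?_⟩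
  · simp only
    rw [tsum_eq_single 0]
    · rfl
    · intro k hk
      obtain ⟨k, rfl⟩ := Nat.exists_eq_succ_of_ne_zero hk
      simp [gsucc]
  · have h0 : (fun t => ∑' k, g k t) = fun t => x + ∑' k, g (k + 1) t := by
      ext1 t
      rw [(hsg t).tsum_eq_zero_add]; rfl
    rw [h0]
    have e : F t (x + ∑' k, g (k + 1) t) = ∑' k, F t (g k t) := by
      rw [← (F t).map_tsum (hsg t), (hsg t).tsum_eq_zero_add]; rfl
    rw [e]
    refine HasDerivAt.const_add x ?_
    have hpos : 0 < |t| + 1 := by positivity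
    have hbd (k : ℕ) (y : ℝ) (hy : y ∈ Metric.ball (0 : ℝ) (|t| + 1)) :
        ‖F y (g k y)‖ ≤ c * ((c * (|t| + 1)) ^ k / k.factorial * ‖x‖) := by
      refine (hF _ _).trans (mul_le_mul_of_nonneg_left ((hgb k y).trans ?_) hc)
      have : |y| ≤ |t| + 1 := by simpa using (mem_ball_zero_iff.1 hy).le
      gcongr
    have hs0 : Summable fun k => g (k + 1) 0 := by simp [gsucc, summable_zero]
    have ht : t ∈ Metric.ball (0 : ℝ) (|t| + 1) := by
      rw [mem_ball_zero_iff, Real.norm_eq_abs]; linarith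
    exact hasDerivAt_tsum_of_isPreconnected ((hsum (|t| + 1)).mul_left c)
      Metric.isOpen_ball (convex_ball _ _).isPreconnected (fun k y _ => hgd k y)
      hbd (Metric.mem_ball_self hpos) hs0 ht

theorem exists_solution (V : S → ℝ) (φ : (hamiltonian V).domain) :
    ∃ ψ, IsSchrodingerSolution V φ ψ := by
  set y : L2 S := -Complex.I • hamiltonian V φ with hy
  have bound (t : ℝ) (u : L2 S) :
      ‖(-Complex.I • (phase V t ∘L hop S ∘L phase V (-t))) u‖ ≤ ‖hop S‖ * ‖u‖ := by
    simp only [neg_smul, neg_apply, smul_apply,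
      norm_neg, norm_smul, Complex.norm_I, one_mul, ContinuousLinearMap.comp_apply]
    refine (norm_phase_le _ _ _).trans (((hop S).le_opNorm _).trans ?_)
    gcongr
    exact norm_phase_le _ _ _
  obtain ⟨χ, hχ0, hχ⟩ := exists_linear_ode
    (fun t => (-Complex.I • (phase V t ∘L hop S ∘L phase V (-t))).restrictScalars ℝ) ‖hop S‖ (norm_nonneg _) bound
    (fun u hu => (continuous_phase V continuous_id ((hop S).continuous.comp
        (continuous_phase V continuous_neg hu))).const_smul (-Complex.I)) y
  have hχc : Continuous χ := continuous_iff_continuousAt.2 fun t => (hχ t).continuousAt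
  set η : ℝ → L2 S := fun t => phase V (-t) (χ t) with hη
  have hηc : Continuous η := continuous_phase V continuous_neg hχc
  set ψ : ℝ → L2 S := fun t => φ + ∫ s in (0 : ℝ)..t, η s with hψ
  have hψd (t : ℝ) : HasDerivAt ψ (η t) t :=
    (intervalIntegral.integral_hasDerivAt_right (hηc.intervalIntegrable _ _)
      (hηc.stronglyMeasurableAtFilter _ _) hηc.continuousAt).const_add _
  have coord (f : ℝ → L2 S) (f' : L2 S) (t : ℝ) (n : S) (h : HasDerivAt f f' t) :
      HasDerivAt (fun s => f s n) (f' n) t :=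
    ((lp.evalCLM ℂ (fun _ : S => ℂ) 2 n).restrictScalars ℝ).hasFDerivAt.comp_hasDerivAt t h
  have hhop (t : ℝ) : HasDerivAt (fun s => hop S (ψ s)) (hop S (η t)) t :=
    ((hop S).restrictScalars ℝ).hasFDerivAt.comp_hasDerivAt t (hψd t)
  have hηd (t : ℝ) (n : S) : HasDerivAt (fun s => η s n)
      (-Complex.I * (V n * η t n + hop S (η t) n)) t := by
    have h1 : HasDerivAt (fun s : ℝ => Complex.exp ((-s : ℝ) * V n * Complex.I))
        (Complex.exp ((-t : ℝ) * V n * Complex.I) * (-V n * Complex.I)) t := by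
      have : HasDerivAt (fun s : ℝ => ((-s : ℝ) : ℂ) * V n * Complex.I)
          (-V n * Complex.I) t := by
        have h0 := ((hasDerivAt_id t).ofReal_comp.const_mul (-(V n : ℂ) * Complex.I))
        convert! h0 using 1
        · ext s; simp; ring
        · simp
      exact this.cexp
    convert! h1.mul (coord _ _ t n (hχ t)) using 1
    have h2 : Complex.exp ((-t : ℝ) * V n * Complex.I) * Complex.exp (t * V n * Complex.I) = 1 := by
      rw [← Complex.exp_add, ← Complex.exp_zero]; congr 1; push_cast; ring
    simp only [ContinuousLinearMap.coe_restrictScalars', neg_smul, neg_apply, smul_apply,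
      ContinuousLinearMap.comp_apply, lp.coeFn_neg, lp.coeFn_smul, Pi.neg_apply, Pi.smul_apply,
      smul_eq_mul, phase_apply, hη]
    linear_combination (Complex.I * hop S (phase V (-t) (χ t)) n) * h2
  have hψ0 : ψ 0 = φ := by simp [hψ]
  have hη0 : η 0 = y := by
    ext n; simp [hη, hχ0, phase_apply]
  have main (t : ℝ) (n : S) : η t n = -Complex.I * (hop S (ψ t) n + V n * ψ t n) := by
    have hd (s : ℝ) : HasDerivAt
        (fun r => η r n + Complex.I * (hop S (ψ r) n + V n * ψ r n)) 0 s := by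
      convert! (hηd s n).add (((coord _ _ s n (hhop s)).add
        ((coord _ _ s n (hψd s)).const_mul (V n : ℂ))).const_mul Complex.I) using 1
      ring
    have := is_const_of_deriv_eq_zero (fun s => (hd s).differentiableAt) (fun s => (hd s).deriv) t 0
    simp only [hψ0, hη0, hy] at this
    have h3 : (-Complex.I • hamiltonian V φ : L2 S) n =
      -Complex.I * (hop S φ n + V n * (φ : L2 S) n) := rfl
    rw [h3] at this
    linear_combination this
  refine ⟨ψ, hψ0, fun t => ?_⟩
  have hm : ψ t ∈ (hamiltonian V).domain := mem_domain (Complex.I • η t) fun n => by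
    change Complex.I * η t n = _
    rw [main]
    linear_combination (-(hop S (ψ t) n + V n * ψ t n)) * Complex.I_mul_I
  refine ⟨hm, ?_⟩
  convert! hψd t using 1
  ext n
  exact (main t n).symm

/-- The Schrödinger equation has exactly one solution for each initial state in the domain. -/
theorem existsUnique_solution (V : S → ℝ) (φ : (hamiltonian V).domain) :
    ∃! ψ, IsSchrodingerSolution V φ ψ := by
  obtain ⟨ψ, hψ⟩ := exists_solution V φ
  exact ⟨ψ, hψ, fun χ hχ => hχ.unique hψ⟩

end

/-- The time evolution `t ↦ exp (-i t H) φ` of a state `φ` in the domain of `H`, which is the unique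
solution of the Schrödinger equation with initial state `φ`. -/
noncomputable def evolution {S : Set ℤ} (V : S → ℝ) (φ : (hamiltonian V).domain) : ℝ → L2 S :=
  (existsUnique_solution V φ).choose

theorem evolution_spec {S : Set ℤ} (V : S → ℝ) (φ : (hamiltonian V).domain) :
    IsSchrodingerSolution V φ (evolution V φ) :=
  (existsUnique_solution V φ).choose_spec.1

/-- The vector `δ_1` of the canonical basis. -/
noncomputable def deltaOne (S : Set ℤ) : L2 S :=
  ⟨fun n => if (n : ℤ) = 1 then 1 else 0, by
    refine memℓp_gen ((hasSum_sum_of_ne_finset_zero (s := Finset.preimage {1} Subtype.val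
      Subtype.val_injective.injOn) fun n hn => ?_).summable)
    have : (n : ℤ) ≠ 1 := by simpa using hn
    simp [this]⟩

theorem deltaOne_apply {S : Set ℤ} (n : S) : deltaOne S n = if (n : ℤ) = 1 then 1 else 0 := rfl

theorem deltaOne_mem_domain {S : Set ℤ} (V : S → ℝ) : deltaOne S ∈ (hamiltonian V).domain := by
  refine mem_domain (hop S (deltaOne S) + ((zeroExt V 1 : ℝ) : ℂ) • deltaOne S) fun n => ?_
  simp only [lp.coeFn_add, lp.coeFn_smul, Pi.add_apply, Pi.smul_apply, smul_eq_mul, deltaOne_apply]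
  by_cases h : (n : ℤ) = 1
  · rw [← h, zeroExt_coe]
  · simp [h]

/-- `ψ(t, n) = ⟨exp (-i t H) δ_1, δ_n⟩`. -/
noncomputable def amplitude {S : Set ℤ} (V : S → ℝ) (t : ℝ) (n : S) : ℂ :=
  evolution V ⟨deltaOne S, deltaOne_mem_domain V⟩ t n

/-- The time-averaged probability `a(n, T) = (1 / T) ∫_0^∞ exp (-2 t / T) |ψ(t, n)|² dt`. -/
noncomputable def timeAverage {S : Set ℤ} (V : S → ℝ) (n : S) (T : ℝ) : ℝ≥0∞ :=
  ENNReal.ofReal (1 / T) *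
    ∫⁻ t in Set.Ioi (0 : ℝ), ENNReal.ofReal (Real.exp (-2 * t / T) * ‖amplitude V t n‖ ^ 2)

/-- The time-averaged moment `⟨|X|^p⟩(T) = ∑_n |n|^p a(n, T)` of the position operator. -/
noncomputable def moment {S : Set ℤ} (V : S → ℝ) (p T : ℝ) : ℝ≥0∞ :=
  ∑' n : S, ENNReal.ofReal (|((n : ℤ) : ℝ)| ^ p) * timeAverage V n T

/-- The lower growth exponent `β⁻(p) = liminf_{T → ∞} log ⟨|X|^p⟩(T) / log T`. -/
noncomputable def betaMinus {S : Set ℤ} (V : S → ℝ) (p : ℝ) : EReal :=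
  liminf (fun T : ℝ => ENNReal.log (moment V p T) / ((Real.log T : ℝ) : EReal)) atTop

/-- The one-step matrix `A(n, z)`. -/
noncomputable def stepMatrix {S : Set ℤ} (V : S → ℝ) (n : ℤ) (z : ℂ) : Matrix (Fin 2) (Fin 2) ℂ :=
  !![z - ((zeroExt V n : ℝ) : ℂ), -1; 1, 0]

/-- The product `A(m + k, z) ⋯ A(m + 1, z)` of `k` one-step matrices. -/
noncomputable def stepProduct {S : Set ℤ} (V : S → ℝ) (m : ℤ) (z : ℂ) :
    ℕ → Matrix (Fin 2) (Fin 2) ℂ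
  | 0 => 1
  | k + 1 => stepMatrix V (m + (k + 1)) z * stepProduct V m z k

/-- The transfer matrix `T(n, m; z)`: it is `A(n, z) ⋯ A(m + 1, z)` for `n > m`, the identity for
`n = m`, and `T(m, n; z)⁻¹` for `n < m`. -/
noncomputable def transfer {S : Set ℤ} (V : S → ℝ) (n m : ℤ) (z : ℂ) :
    Matrix (Fin 2) (Fin 2) ℂ :=
  if m ≤ n then stepProduct V m z (n - m).toNat else (stepProduct V n z (m - n).toNat)⁻¹

/-- The power-law hypothesis: for all large `N`, the set `A N` is a nonempty Borel subset of
`[-K, K]`, and `‖T(n, m; E)‖ ≤ C N ^ α` for all `E ∈ A N` and all sites `|n|, |m| ≤ N`. The norm is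
the operator norm for the Euclidean norm on `ℂ²`. -/
def PowerLawBound {S : Set ℤ} (V : S → ℝ) (K C α : ℝ) (A : ℝ → Set ℝ) : Prop :=
  ∀ᶠ N : ℝ in atTop, (A N).Nonempty ∧ MeasurableSet (A N) ∧ A N ⊆ Set.Icc (-K) K ∧
    ∀ E ∈ A N, ∀ n m : S, |((n : ℤ) : ℝ)| ≤ N → |((m : ℤ) : ℝ)| ≤ N →
      ‖transfer V n m (E : ℂ)‖ ≤ C * N ^ α

/-- `N(T) = T ^ (1 / (1 + α))`. -/
noncomputable def scale (α T : ℝ) : ℝ := T ^ (1 / (1 + α))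

/-- The closed `1 / T`-neighborhood `B(T)` of `A(N(T))`. -/
def energyNhd (A : ℝ → Set ℝ) (α T : ℝ) : Set ℝ :=
  {E | ∃ E' ∈ A (scale α T), |E - E'| ≤ 1 / T}

end Schrodinger

/-!
By Parseval, `a(n, T) = (2πT)⁻¹ ∫ |G(x + i/T, n)|² dx`, where `G(z, n)` is the Green function with
source at the site `1`. Since `G` solves the difference equation up to a unit source at `1`, its
Cauchy data cannot be small on both bonds next to the source. From there, the data at distance `n`
can only decay as fast as the inverse of the norm of the transfer matrices of `V₀`: the fixed window
containing the support of `W` costs only a constant factor, and outside it `V₀ + W` and `V₀` have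
the same transfer matrices. By Duhamel's formula and a discrete Gronwall inequality, a bound
`C N ^ α` on `[-N, N]` at a real energy persists, up to a constant, at complex energies within
`2 / N ^ (1 + α)`, which is `2 / T` for `N = N(T)`. Hence `|G(x + i/T, ·)|²` has mass at least
`c N ^ (1 - 2α)` on `|n| ≥ N / 2` for every `x ∈ B(T)`, and integrating over `B(T)` gives the bounds
of part (1). Parts (2) and (3) apply it to a single energy and to intervals of radius `N ^ (-1/θ)`.
-/

namespace Schrodinger

section Plancherel

open FourierTransform ContDiff

variable {E F : Type*} [NormedAddCommGroup E] [InnerProductSpace ℝ E] [FiniteDimensional ℝ E]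
  [MeasurableSpace E] [BorelSpace E] [NormedAddCommGroup F] [InnerProductSpace ℂ F]
  [CompleteSpace F]

theorem fourier_toLp_ae_eq_fourier {f : E → F} (h₁ : Integrable f) (h₂ : MemLp f 2) :
    (𝓕 (h₂.toLp f) : Lp F 2 (volume : Measure E)) =ᵐ[volume] 𝓕 f := by
  have hcont : Continuous (𝓕 f) :=
    VectorFourier.fourierIntegral_continuous Real.continuous_fourierChar continuous_inner h₁
  refine ae_eq_of_integral_contDiff_smul_eq ((Lp.memLp _).locallyIntegrable (by norm_num))
    hcont.locallyIntegrable fun g hg hgc => ?_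
  have hg₁ : HasCompactSupport (Complex.ofRealCLM ∘ g) := hgc.comp_left rfl
  have hg₂ : ContDiff ℝ ∞ (Complex.ofRealCLM ∘ g) := by fun_prop
  set G := hg₁.toSchwartzMap hg₂ with hG
  have hswap : ∫ ξ, 𝓕 (G : E → ℂ) ξ • f ξ = ∫ x, G x • 𝓕 f x := by
    simpa using! VectorFourier.integral_fourierIntegral_smul_eq_flip (L := innerₗ E)
      Real.continuous_fourierChar continuous_inner G.integrable h₁
  calc ∫ x, g x • (𝓕 (h₂.toLp f) : Lp F 2 (volume : Measure E)) x
      = Lp.toTemperedDistribution (𝓕 (h₂.toLp f)) G := by simp [hG]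
    _ = ∫ ξ, 𝓕 G ξ • h₂.toLp f ξ := by
        rw [← Lp.fourier_toTemperedDistribution_eq, TemperedDistribution.fourier_apply,
          Lp.toTemperedDistribution_apply]
    _ = ∫ ξ, 𝓕 G ξ • f ξ :=
        integral_congr_ae (h₂.coeFn_toLp.mono fun ξ hξ => by simp only [hξ])
    _ = ∫ x, g x • 𝓕 f x := by rw [SchwartzMap.fourier_coe, hswap]; simp [hG]

theorem lintegral_enorm_fourier_sq {f : E → F} (h₁ : Integrable f) (h₂ : MemLp f 2) :
    ∫⁻ ξ, ‖𝓕 f ξ‖ₑ ^ 2 = ∫⁻ x, ‖f x‖ₑ ^ 2 := by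
  have hnorm : eLpNorm (𝓕 f) 2 volume = eLpNorm f 2 volume := by
    rw [← eLpNorm_congr_ae (fourier_toLp_ae_eq_fourier h₁ h₂), ← eLpNorm_congr_ae h₂.coeFn_toLp,
      ← Lp.enorm_def, ← Lp.enorm_def, ← ofReal_norm, ← ofReal_norm, Lp.norm_fourier_eq]
  have hsq (g : E → F) : ∫⁻ x, ‖g x‖ₑ ^ 2 = eLpNorm g 2 volume ^ 2 := by
    rw [eLpNorm_eq_lintegral_rpow_enorm_toReal (by norm_num) (by norm_num), ← ENNReal.rpow_natCast,
      ← ENNReal.rpow_mul]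
    norm_num
  rw [hsq, hsq, hnorm]

end Plancherel

section Laplace

variable {F : Type*} [NormedAddCommGroup F] [NormedSpace ℂ F] {f g : ℝ → F} {z : ℂ}

/-- The Laplace transform in the variable natural for quantum dynamics: it sends `e ^ (-itH) φ` to
the resolvent `-i (H - z)⁻¹ φ`, and `Im z` is the damping rate. -/
noncomputable def laplace (f : ℝ → F) (z : ℂ) : F :=
  ∫ t in Set.Ioi (0 : ℝ), Complex.exp (Complex.I * z * t) • f t

/-- Absolute convergence of the integral defining `laplace f z`. -/
def LaplaceIntegrable (f : ℝ → F) (z : ℂ) : Prop :=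
  IntegrableOn (fun t : ℝ => Complex.exp (Complex.I * z * t) • f t) (Set.Ioi 0)

theorem norm_exp_I_mul_mul (z : ℂ) (t : ℝ) :
    ‖Complex.exp (Complex.I * z * t)‖ = Real.exp (-z.im * t) := by
  simp [Complex.norm_exp]

theorem LaplaceIntegrable.of_norm_le {M : ℝ} (hz : 0 < z.im)
    (hf : AEStronglyMeasurable f (volume.restrict (Set.Ioi 0))) (hM : ∀ t, ‖f t‖ ≤ M) :
    LaplaceIntegrable f z := by
  refine ((integrableOn_exp_mul_Ioi (neg_neg_of_pos hz) 0).mul_const M).mono'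
    (AEStronglyMeasurable.smul (by fun_prop) hf) (ae_of_all _ fun t => ?_)
  rw [norm_smul, norm_exp_I_mul_mul]
  gcongr
  exact hM t

theorem LaplaceIntegrable.add (hf : LaplaceIntegrable f z) (hg : LaplaceIntegrable g z) :
    LaplaceIntegrable (f + g) z := by
  simpa only [LaplaceIntegrable, Pi.add_apply, smul_add] using! Integrable.add hf hg

theorem LaplaceIntegrable.const_smul (hf : LaplaceIntegrable f z) (c : ℂ) :
    LaplaceIntegrable (c • f) z := by
  simpa only [LaplaceIntegrable, Pi.smul_apply, smul_comm _ c] using! Integrable.smul c hf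

theorem laplace_add (hf : LaplaceIntegrable f z) (hg : LaplaceIntegrable g z) :
    laplace (f + g) z = laplace f z + laplace g z := by
  simpa only [laplace, Pi.add_apply, smul_add] using integral_add hf hg

theorem laplace_const_smul (c : ℂ) (f : ℝ → F) (z : ℂ) :
    laplace (c • f) z = c • laplace f z := by
  simp only [laplace, Pi.smul_apply, smul_comm _ c, integral_smul]

theorem laplace_deriv [CompleteSpace F] {f' : ℝ → F} (hd : ∀ t, HasDerivAt f (f' t) t)
    (hf : LaplaceIntegrable f z) (hf' : LaplaceIntegrable f' z) :
    laplace f' z = -f 0 - (Complex.I * z) • laplace f z := by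
  have hexp (t : ℝ) : HasDerivAt (fun s : ℝ => Complex.exp (Complex.I * z * s))
      (Complex.exp (Complex.I * z * t) * (Complex.I * z)) t := by
    simpa using ((hasDerivAt_id t).ofReal_comp.const_mul (Complex.I * z)).cexp
  have hderiv (t : ℝ) : HasDerivAt (fun s : ℝ => Complex.exp (Complex.I * z * s) • f s)
      (Complex.exp (Complex.I * z * t) • (f' + (Complex.I * z) • f) t) t := by
    simpa only [Pi.add_apply, Pi.smul_apply, smul_add, smul_smul] using! (hexp t).smul (hd t)
  have hint := hf'.add (hf.const_smul (Complex.I * z))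
  have hftc : laplace (f' + (Complex.I * z) • f) z = -f 0 := by
    refine (integral_Ioi_of_hasDerivAt_of_tendsto (hderiv 0).continuousAt.continuousWithinAt
      (fun t _ => hderiv t) hint
      (tendsto_zero_of_hasDerivAt_of_integrableOn_Ioi (fun t _ => hderiv t) hint hf)).trans ?_
    simp
  rw [laplace_add hf' (hf.const_smul _), laplace_const_smul] at hftc
  rw [← hftc, add_sub_cancel_right]

open FourierTransform in
theorem laplace_eq_fourier (f : ℝ → F) (x η : ℝ) :
    laplace f (x + η * Complex.I) = 𝓕 ((Set.Ioi 0).indicator fun t : ℝ =>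
      Complex.exp (Complex.I * (η * Complex.I) * t) • f t) (-(2 * Real.pi)⁻¹ * x) := by
  have hpi : (Real.pi : ℂ) ≠ 0 := mod_cast Real.pi_ne_zero
  rw [Real.fourier_real_eq_integral_exp_smul, laplace, ← integral_indicator measurableSet_Ioi]
  congr 1 with t
  simp only [Set.indicator_apply]
  split_ifs
  · rw [smul_smul, ← Complex.exp_add]
    congr 2
    push_cast
    field_simp
  · rw [smul_zero]

theorem continuous_laplace_horizontal {η : ℝ} (hf : LaplaceIntegrable f (η * Complex.I)) :
    Continuous fun x : ℝ => laplace f (x + η * Complex.I) := by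
  simp_rw [laplace_eq_fourier]
  exact (VectorFourier.fourierIntegral_continuous Real.continuous_fourierChar continuous_inner
    ((integrable_indicator_iff measurableSet_Ioi).2 hf)).comp (by fun_prop)

theorem lintegral_comp_mul_left (h : ℝ → ℝ≥0∞) {a : ℝ} (ha : a ≠ 0) :
    ∫⁻ x, h (a * x) = ENNReal.ofReal |a⁻¹| * ∫⁻ x, h x := by
  rw [← smul_eq_mul, ← lintegral_smul_measure, ← Real.map_volume_mul_left ha]
  exact ((Homeomorph.mulLeft₀ a ha).measurableEmbedding.lintegral_map h).symm

end Laplace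

open FourierTransform in
theorem lintegral_exp_mul_norm_sq {F : Type*} [NormedAddCommGroup F] [InnerProductSpace ℂ F]
    [CompleteSpace F] {f : ℝ → F} {M η : ℝ} (hη : 0 < η)
    (hf : AEStronglyMeasurable f (volume.restrict (Set.Ioi 0))) (hM : ∀ t, ‖f t‖ ≤ M) :
    ∫⁻ t in Set.Ioi (0 : ℝ), ENNReal.ofReal (Real.exp (-2 * η * t) * ‖f t‖ ^ 2) =
      ENNReal.ofReal (2 * Real.pi)⁻¹ * ∫⁻ x : ℝ, ‖laplace f (x + η * Complex.I)‖ₑ ^ 2 := by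
  set g : ℝ → F := (Set.Ioi 0).indicator fun t =>
    Complex.exp (Complex.I * (η * Complex.I) * t) • f t with hg
  have hg_sq : (fun t => ‖g t‖ ^ 2) =
      (Set.Ioi 0).indicator fun t => Real.exp (-2 * η * t) * ‖f t‖ ^ 2 := by
    ext t
    simp only [hg, Set.indicator_apply]
    split_ifs
    · rw [norm_smul, norm_exp_I_mul_mul, mul_pow, ← Real.exp_nat_mul]
      simp [mul_assoc]
    · simp
  have hg₁ : Integrable g := (integrable_indicator_iff measurableSet_Ioi).2
    (LaplaceIntegrable.of_norm_le (by simpa using hη) hf hM)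
  have hg₂ : MemLp g 2 := by
    rw [memLp_two_iff_integrable_sq_norm hg₁.aestronglyMeasurable, hg_sq,
      integrable_indicator_iff measurableSet_Ioi]
    refine ((integrableOn_exp_mul_Ioi (by linarith : -2 * η < 0) 0).mul_const (M ^ 2)).mono'
      (AEStronglyMeasurable.mul (by fun_prop) (hf.norm.pow 2)) (ae_of_all _ fun t => ?_)
    rw [Real.norm_of_nonneg (by positivity)]
    gcongr
    exact hM t
  calc ∫⁻ t in Set.Ioi (0 : ℝ), ENNReal.ofReal (Real.exp (-2 * η * t) * ‖f t‖ ^ 2)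
      = ∫⁻ t, ‖g t‖ₑ ^ 2 := by
        rw [← lintegral_indicator measurableSet_Ioi]
        congr 1 with t
        rw [← ofReal_norm, ← ENNReal.ofReal_pow (norm_nonneg _), congrFun hg_sq t]
        simp only [Set.indicator_apply]
        split_ifs <;> simp
    _ = ∫⁻ ξ, ‖𝓕 g ξ‖ₑ ^ 2 := (lintegral_enorm_fourier_sq hg₁ hg₂).symm
    _ = ENNReal.ofReal (2 * Real.pi)⁻¹ * ∫⁻ x : ℝ, ‖𝓕 g (-(2 * Real.pi)⁻¹ * x)‖ₑ ^ 2 := by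
        rw [lintegral_comp_mul_left (fun ξ => ‖𝓕 g ξ‖ₑ ^ 2) (by simp [Real.pi_ne_zero]),
          inv_neg, inv_inv, abs_neg, abs_of_pos Real.two_pi_pos, ← mul_assoc,
          ← ENNReal.ofReal_mul (by positivity), inv_mul_cancel₀ Real.two_pi_pos.ne',
          ENNReal.ofReal_one, one_mul]
    _ = _ := by simp_rw [laplace_eq_fourier, hg]

section Green

variable {S : Set ℤ} (V : S → ℝ)

theorem hasDerivAt_amplitude (n : S) (t : ℝ) :
    HasDerivAt (fun s => amplitude V s n) (-Complex.I * formalH V (amplitude V t) n) t := by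
  obtain ⟨_, hd⟩ := (evolution_spec V ⟨deltaOne S, deltaOne_mem_domain V⟩).2 t
  exact ((lp.evalCLM ℂ (fun _ : S => ℂ) 2 n).restrictScalars ℝ).hasFDerivAt.comp_hasDerivAt t hd

theorem continuous_amplitude (n : S) : Continuous fun t => amplitude V t n :=
  continuous_iff_continuousAt.2 fun t => (hasDerivAt_amplitude V n t).continuousAt

theorem amplitude_zero (n : S) : amplitude V 0 n = if (n : ℤ) = 1 then 1 else 0 := by
  rw [amplitude, (evolution_spec V ⟨deltaOne S, deltaOne_mem_domain V⟩).1]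
  rfl

theorem norm_amplitude_le (n : S) (t : ℝ) : ‖amplitude V t n‖ ≤ ‖deltaOne S‖ :=
  (lp.norm_apply_le_norm (by norm_num) _ n).trans_eq
    ((evolution_spec V ⟨deltaOne S, deltaOne_mem_domain V⟩).norm_eq t)

theorem laplaceIntegrable_amplitude {z : ℂ} (hz : 0 < z.im) (n : S) :
    LaplaceIntegrable (fun t => amplitude V t n) z :=
  .of_norm_le hz (continuous_amplitude V n).aestronglyMeasurable (norm_amplitude_le V n)

theorem laplaceIntegrable_zeroExt_amplitude {z : ℂ} (hz : 0 < z.im) (k : ℤ) :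
    LaplaceIntegrable (fun t => zeroExt (amplitude V t) k) z := by
  by_cases hk : k ∈ S
  · simpa [zeroExt, hk] using laplaceIntegrable_amplitude V hz ⟨k, hk⟩
  · simp [zeroExt, hk, LaplaceIntegrable]

/-- The Green function `-i ⟨δ_n, (H - z)⁻¹ δ_1⟩` for `Im z > 0`, as the Laplace transform of the
time evolution. -/
noncomputable def green (z : ℂ) (n : S) : ℂ := laplace (fun t => amplitude V t n) z

theorem zeroExt_green (z : ℂ) (k : ℤ) :
    zeroExt (green V z) k = laplace (fun t => zeroExt (amplitude V t) k) z := by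
  by_cases hk : k ∈ S <;> simp [zeroExt, hk, green, laplace]

theorem continuous_green_horizontal {η : ℝ} (hη : 0 < η) (n : S) :
    Continuous fun x : ℝ => green V (x + η * Complex.I) n :=
  continuous_laplace_horizontal (laplaceIntegrable_amplitude V (by simpa using hη) n)

theorem formalH_green {z : ℂ} (hz : 0 < z.im) (n : S) :
    formalH V (green V z) n - z * green V z n = if (n : ℤ) = 1 then -Complex.I else 0 := by
  have hleft := laplaceIntegrable_zeroExt_amplitude V hz (n - 1)
  have hright := laplaceIntegrable_zeroExt_amplitude V hz (n + 1)
  have hself := laplaceIntegrable_amplitude V hz n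
  have hsplit : (fun t => formalH V (amplitude V t) n) =
      (fun t => zeroExt (amplitude V t) (n - 1)) + (fun t => zeroExt (amplitude V t) (n + 1)) +
        (V n : ℂ) • fun t => amplitude V t n := rfl
  have hH : LaplaceIntegrable (fun t => formalH V (amplitude V t) n) z :=
    hsplit ▸ (hleft.add hright).add (hself.const_smul _)
  have hlaplace : laplace (fun t => formalH V (amplitude V t) n) z = formalH V (green V z) n := by
    rw [hsplit, laplace_add (hleft.add hright) (hself.const_smul _), laplace_add hleft hright,
      laplace_const_smul, ← zeroExt_green, ← zeroExt_green]
    rfl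
  have hderiv : -Complex.I * formalH V (green V z) n =
      -amplitude V 0 n - Complex.I * z * green V z n := by
    rw [← hlaplace]
    exact (laplace_const_smul _ _ _).symm.trans
      (laplace_deriv (hasDerivAt_amplitude V n) hself (hH.const_smul _))
  have hsource : formalH V (green V z) n - z * green V z n = -Complex.I * amplitude V 0 n := by
    linear_combination Complex.I * hderiv -
      (z * green V z n - formalH V (green V z) n) * Complex.I_mul_I
  rw [hsource, amplitude_zero, mul_ite, mul_one, mul_zero]

theorem timeAverage_eq_lintegral_green (n : S) {T : ℝ} (hT : 0 < T) :
    timeAverage V n T = ENNReal.ofReal (2 * Real.pi * T)⁻¹ *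
      ∫⁻ x : ℝ, ‖green V (x + (T⁻¹ : ℝ) * Complex.I) n‖ₑ ^ 2 := by
  rw [mul_inv_rev, ENNReal.ofReal_mul (by positivity), mul_assoc, timeAverage, one_div]
  congr 1
  exact Eq.trans (by simp only [div_eq_mul_inv, mul_right_comm])
    (lintegral_exp_mul_norm_sq (inv_pos.2 hT)
      (continuous_amplitude V n).aestronglyMeasurable (norm_amplitude_le V n))

end Green

section Matrix

variable {𝕜 : Type*} [RCLike 𝕜]

theorem norm_entry_le_l2_opNorm {m n : Type*} [Fintype m] [Fintype n] [DecidableEq n]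
    (P : Matrix m n 𝕜) (i : m) (j : n) : ‖P i j‖ ≤ ‖P‖ :=
  calc ‖P i j‖
      = ‖(EuclideanSpace.equiv m 𝕜).symm (P.mulVec (EuclideanSpace.single j 1).ofLp) i‖ := by
        simp
    _ ≤ ‖P‖ * ‖EuclideanSpace.single j (1 : 𝕜)‖ :=
        (PiLp.norm_apply_le _ i).trans (P.l2_opNorm_mulVec _)
    _ = ‖P‖ := by simp

/-- By Cayley–Hamilton, `P⁻¹ = tr P - P`. -/
theorem norm_inv_le_of_det_eq_one {P : Matrix (Fin 2) (Fin 2) 𝕜} (hP : P.det = 1) :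
    ‖P⁻¹‖ ≤ 3 * ‖P‖ := by
  have hinv : P⁻¹ = P.trace • (1 : Matrix (Fin 2) (Fin 2) 𝕜) - P := by
    rw [Matrix.inv_def, hP, Ring.inverse_one, one_smul, Matrix.adjugate_fin_two]
    ext i j
    fin_cases i <;> fin_cases j <;> simp [Matrix.trace_fin_two]
  have htrace : ‖P.trace‖ ≤ 2 * ‖P‖ := by
    rw [Matrix.trace_fin_two]
    linarith [norm_add_le (P 0 0) (P 1 1), norm_entry_le_l2_opNorm P 0 0,
      norm_entry_le_l2_opNorm P 1 1]
  calc ‖P⁻¹‖ ≤ ‖P.trace • (1 : Matrix (Fin 2) (Fin 2) 𝕜)‖ + ‖P‖ := hinv ▸ norm_sub_le _ _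
    _ = ‖P.trace‖ + ‖P‖ := by rw [norm_smul, CStarRing.norm_one, mul_one]
    _ ≤ 3 * ‖P‖ := by linarith

end Matrix

section Transfer

variable {S : Set ℤ} (V : S → ℝ)

theorem det_stepMatrix (n : ℤ) (z : ℂ) : (stepMatrix V n z).det = 1 := by
  simp [stepMatrix, Matrix.det_fin_two_of]

theorem det_stepProduct (m : ℤ) (z : ℂ) (k : ℕ) : (stepProduct V m z k).det = 1 := by
  induction k with
  | zero => exact Matrix.det_one
  | succ k ih => rw [stepProduct, Matrix.det_mul, ih, det_stepMatrix, one_mul]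

theorem isUnit_det_stepProduct (m : ℤ) (z : ℂ) (k : ℕ) : IsUnit (stepProduct V m z k).det :=
  det_stepProduct V m z k ▸ isUnit_one

theorem stepProduct_add (m : ℤ) (z : ℂ) (j k : ℕ) :
    stepProduct V m z (j + k) = stepProduct V (m + j) z k * stepProduct V m z j := by
  induction k with
  | zero => exact (one_mul _).symm
  | succ k ih =>
    rw [← add_assoc, stepProduct, ih, stepProduct, mul_assoc]
    congr 2
    push_cast
    ring

theorem stepProduct_one (m : ℤ) (z : ℂ) : stepProduct V m z 1 = stepMatrix V (m + 1) z := by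
  simp [stepProduct]

variable {V} in
theorem stepProduct_congr {V' : S → ℝ} {m : ℤ} {k : ℕ}
    (h : ∀ n ∈ Set.Ioc m (m + k), zeroExt V n = zeroExt V' n) (z : ℂ) :
    stepProduct V m z k = stepProduct V' m z k := by
  induction k with
  | zero => rfl
  | succ k ih =>
    push_cast at h
    rw [stepProduct, stepProduct, ih fun n hn => h n ⟨hn.1, by linarith [hn.2]⟩, stepMatrix,
      stepMatrix, h _ ⟨by omega, le_rfl⟩]

theorem continuous_stepProduct (m : ℤ) (k : ℕ) : Continuous fun z => stepProduct V m z k := by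
  induction k with
  | zero => exact continuous_const
  | succ k ih =>
    refine Continuous.mul (continuous_matrix fun i j => ?_) ih
    fin_cases i <;> fin_cases j
    exacts [continuous_id.sub continuous_const, continuous_const, continuous_const,
      continuous_const]

theorem exists_norm_stepProduct_le (m : ℤ) (k : ℕ) (r : ℝ) :
    ∃ R, ∀ z ∈ Metric.closedBall (0 : ℂ) r, ‖stepProduct V m z k‖ ≤ R :=
  (isCompact_closedBall 0 r).exists_bound_of_continuousOn
    (continuous_stepProduct V m k).continuousOn

theorem transfer_add_right (m : ℤ) (k : ℕ) (z : ℂ) :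
    transfer V (m + k) m z = stepProduct V m z k := by
  simp [transfer]

theorem transfer_eq_mul_inv {b n m : ℤ} (hn : b ≤ n) (hm : b ≤ m) (z : ℂ) :
    transfer V n m z =
      stepProduct V b z (n - b).toNat * (stepProduct V b z (m - b).toNat)⁻¹ := by
  have hsplit {n m : ℤ} (hm : b ≤ m) (hmn : m ≤ n) : stepProduct V b z (n - b).toNat =
      stepProduct V m z (n - m).toNat * stepProduct V b z (m - b).toNat := by
    have h := stepProduct_add V b z (m - b).toNat (n - m).toNat
    rwa [show (m - b).toNat + (n - m).toNat = (n - b).toNat by omega,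
      show b + ((m - b).toNat : ℤ) = m by omega] at h
  have hunit := isUnit_det_stepProduct V b z
  rw [transfer]
  split_ifs with hmn
  · rw [hsplit hm hmn, Matrix.mul_nonsing_inv_cancel_right _ _ (hunit _)]
  · rw [hsplit hn (le_of_not_ge hmn), Matrix.mul_inv_rev,
      Matrix.mul_nonsing_inv_cancel_left _ _ (hunit _)]

theorem transfer_mul_transfer (n l m : ℤ) (z : ℂ) :
    transfer V n l z * transfer V l m z = transfer V n m z := by
  obtain ⟨b, hn, hl, hm⟩ : ∃ b, b ≤ n ∧ b ≤ l ∧ b ≤ m := ⟨min n (min l m), by simp⟩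
  rw [transfer_eq_mul_inv V hn hl, transfer_eq_mul_inv V hl hm, transfer_eq_mul_inv V hn hm,
    ← mul_assoc, Matrix.nonsing_inv_mul_cancel_right _ _ (isUnit_det_stepProduct V _ _ _)]

theorem norm_transfer_symm_le (n m : ℤ) (z : ℂ) :
    ‖transfer V n m z‖ ≤ 3 * ‖transfer V m n z‖ := by
  have hdet : (transfer V m n z).det = 1 := by
    rw [transfer_eq_mul_inv V (min_le_left m n) (min_le_right m n), Matrix.det_mul,
      Matrix.det_nonsing_inv, det_stepProduct, det_stepProduct, Ring.inverse_one, one_mul]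
  have hinv : transfer V n m z = (transfer V m n z)⁻¹ := by
    refine (Matrix.inv_eq_left_inv ?_).symm
    rw [transfer_mul_transfer]
    simp [transfer, stepProduct]
  exact hinv ▸ norm_inv_le_of_det_eq_one hdet

theorem norm_transfer_le_mul (n l m : ℤ) (z : ℂ) :
    ‖transfer V n m z‖ ≤ ‖transfer V n l z‖ * (3 * ‖transfer V m l z‖) := by
  rw [← transfer_mul_transfer V n l m]
  exact (norm_mul_le _ _).trans (by gcongr; exact norm_transfer_symm_le V l m z)

end Transfer

section Duhamel

variable {S : Set ℤ} (V : S → ℝ)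

theorem stepMatrix_sub_stepMatrix (n : ℤ) (z E : ℂ) :
    stepMatrix V n z - stepMatrix V n E = Matrix.diagonal ![z - E, 0] := by
  ext i j
  fin_cases i <;> fin_cases j <;> simp [stepMatrix]

theorem norm_stepMatrix_sub_stepMatrix_le (n : ℤ) (z E : ℂ) :
    ‖stepMatrix V n z - stepMatrix V n E‖ ≤ ‖z - E‖ := by
  rw [stepMatrix_sub_stepMatrix, Matrix.l2_opNorm_diagonal,
    pi_norm_le_iff_of_nonneg (norm_nonneg _)]
  intro i
  fin_cases i <;> simp

theorem stepProduct_sub_stepProduct (m : ℤ) (z E : ℂ) (k : ℕ) :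
    stepProduct V m z k - stepProduct V m E k = ∑ j ∈ Finset.range k,
      stepProduct V (m + (j + 1 : ℕ)) E (k - (j + 1)) *
        ((stepMatrix V (m + (j + 1)) z - stepMatrix V (m + (j + 1)) E) *
          stepProduct V m z j) := by
  -- telescope the products that use the energy `z` on the first `j` steps and `E` afterwards
  have htel := Finset.sum_range_sub
    (fun j => stepProduct V (m + j) E (k - j) * stepProduct V m z j) k
  simp only [tsub_self, tsub_zero, Nat.cast_zero, add_zero, stepProduct, one_mul, mul_one] at htel
  rw [← htel]
  refine Finset.sum_congr rfl fun j hj => ?_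
  have hfirst : stepProduct V (m + j) E (k - j) =
      stepProduct V (m + (j + 1 : ℕ)) E (k - (j + 1)) * stepMatrix V (m + (j + 1)) E := by
    have h := stepProduct_add V (m + j) E 1 (k - (j + 1))
    rw [show 1 + (k - (j + 1)) = k - j by have := Finset.mem_range.1 hj; omega,
      stepProduct_one] at h
    simpa [add_assoc] using h
  rw [hfirst, sub_mul, mul_sub, mul_assoc]

theorem le_mul_pow_of_le_add_mul_sum {x : ℕ → ℝ} {a b : ℝ} (hb : 0 ≤ b) {k : ℕ}
    (h : ∀ i ≤ k, x i ≤ a + b * ∑ j ∈ Finset.range i, x j) : x k ≤ a * (1 + b) ^ k := by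
  induction k using Nat.strong_induction_on with
  | _ k ih =>
    have hsum : ∑ j ∈ Finset.range k, x j ≤ ∑ j ∈ Finset.range k, a * (1 + b) ^ j :=
      Finset.sum_le_sum fun j hj =>
        have hjk := Finset.mem_range.1 hj
        ih j hjk fun i hi => h i (hi.trans hjk.le)
    calc x k ≤ a + b * ∑ j ∈ Finset.range k, a * (1 + b) ^ j :=
          (h k le_rfl).trans (by gcongr)
      _ = a * (1 + b) ^ k := by
        rw [← Finset.mul_sum]
        linear_combination a * geom_sum_mul (1 + b) k

theorem norm_stepProduct_le_mul_pow {m : ℤ} {E : ℂ} {D : ℝ} {k : ℕ}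
    (h : ∀ i j : ℕ, i + j ≤ k → ‖stepProduct V (m + i) E j‖ ≤ D) (z : ℂ) :
    ‖stepProduct V m z k‖ ≤ D * (1 + D * ‖z - E‖) ^ k := by
  have hD : 0 ≤ D := (norm_nonneg _).trans (h 0 0 (Nat.zero_le _))
  refine le_mul_pow_of_le_add_mul_sum (x := fun k => ‖stepProduct V m z k‖) (by positivity)
    fun i hi => ?_
  rw [← add_sub_cancel (stepProduct V m E i) (stepProduct V m z i), stepProduct_sub_stepProduct,
    Finset.mul_sum]
  refine (norm_add_le _ _).trans (add_le_add (by simpa using h 0 i (by omega)) ?_)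
  refine (norm_sum_le _ _).trans (Finset.sum_le_sum fun j hj => ?_)
  have hji := Finset.mem_range.1 hj
  rw [mul_assoc]
  refine (norm_mul_le _ _).trans
    (mul_le_mul (h (j + 1) _ (by omega)) ?_ (norm_nonneg _) hD)
  exact (norm_mul_le _ _).trans (by gcongr; exact norm_stepMatrix_sub_stepMatrix_le V _ z E)

end Duhamel

section Solution

variable {S : Set ℤ} {V : S → ℝ} {z : ℂ} {g : ℤ → ℂ} {m : ℤ} {k : ℕ}

/-- `g` solves the difference equation `H_V g = z g` at the sites of `s`, with `V` extended by zero
outside `S`. -/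
def IsSolutionOn (V : S → ℝ) (z : ℂ) (g : ℤ → ℂ) (s : Set ℤ) : Prop :=
  ∀ n ∈ s, g (n - 1) + g (n + 1) + (zeroExt V n : ℝ) * g n = z * g n

/-- The Cauchy data `(g (n + 1), g n)`, on which the transfer matrices act. -/
noncomputable def cauchyData (g : ℤ → ℂ) (n : ℤ) : EuclideanSpace ℂ (Fin 2) :=
  !₂[g (n + 1), g n]

theorem norm_cauchyData_sq (g : ℤ → ℂ) (n : ℤ) :
    ‖cauchyData g n‖ ^ 2 = ‖g (n + 1)‖ ^ 2 + ‖g n‖ ^ 2 := by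
  simp [EuclideanSpace.norm_sq_eq, cauchyData]

theorem cauchyData_eq_add (V : S → ℝ) (z : ℂ) (g : ℤ → ℂ) (n : ℤ) :
    cauchyData g n =
      Matrix.toEuclideanCLM (𝕜 := ℂ) (stepMatrix V n z) (cauchyData g (n - 1)) +
        PiLp.single 2 0 (g (n - 1) + g (n + 1) + (zeroExt V n : ℝ) * g n - z * g n) := by
  ext i
  fin_cases i
  · have : g (n + 1) = (z - (zeroExt V n : ℝ)) * g n - g (n - 1) +
        (g (n - 1) + g (n + 1) + (zeroExt V n : ℝ) * g n - z * g n) := by ring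
    simpa [cauchyData, stepMatrix, Matrix.mulVec_eq_sum, sub_eq_add_neg, mul_comm] using! this
  · simp [cauchyData, stepMatrix, Matrix.mulVec_eq_sum]

theorem norm_source_le (V : S → ℝ) (z : ℂ) (g : ℤ → ℂ) (n : ℤ) :
    ‖g (n - 1) + g (n + 1) + (zeroExt V n : ℝ) * g n - z * g n‖ ≤
      ‖cauchyData g n‖ + ‖stepMatrix V n z‖ * ‖cauchyData g (n - 1)‖ := by
  have h := sub_eq_of_eq_add' (cauchyData_eq_add V z g n)
  rw [← PiLp.norm_single 2 (fun _ : Fin 2 => ℂ) 0, ← h, ← Matrix.l2_opNorm_toEuclideanCLM]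
  exact (norm_sub_le _ _).trans (by gcongr; exact ContinuousLinearMap.le_opNorm _ _)

theorem IsSolutionOn.cauchyData_add (hg : IsSolutionOn V z g (Set.Ioc m (m + k))) :
    cauchyData g (m + k) =
      Matrix.toEuclideanCLM (𝕜 := ℂ) (stepProduct V m z k) (cauchyData g m) := by
  induction k with
  | zero => simp [stepProduct]
  | succ k ih =>
    push_cast at hg ⊢
    rw [stepProduct, map_mul, mul_apply_eq_comp, ← ih fun n hn => hg n ⟨hn.1, by linarith [hn.2]⟩,
      cauchyData_eq_add V z, hg _ ⟨by omega, le_rfl⟩, sub_self,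
      (PiLp.single_eq_zero_iff 2 0).2 rfl, add_zero, ← add_assoc, add_sub_cancel_right]

theorem IsSolutionOn.norm_cauchyData_add_le (hg : IsSolutionOn V z g (Set.Ioc m (m + k))) :
    ‖cauchyData g (m + k)‖ ≤ ‖stepProduct V m z k‖ * ‖cauchyData g m‖ := by
  rw [hg.cauchyData_add, ← Matrix.l2_opNorm_toEuclideanCLM]
  exact ContinuousLinearMap.le_opNorm _ _

theorem IsSolutionOn.norm_cauchyData_le (hg : IsSolutionOn V z g (Set.Ioc m (m + k))) :
    ‖cauchyData g m‖ ≤ 3 * ‖stepProduct V m z k‖ * ‖cauchyData g (m + k)‖ := by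
  have hback : cauchyData g m =
      Matrix.toEuclideanCLM (𝕜 := ℂ) (stepProduct V m z k)⁻¹ (cauchyData g (m + k)) := by
    rw [hg.cauchyData_add, ← mul_apply_eq_comp, ← map_mul,
      Matrix.nonsing_inv_mul _ (isUnit_det_stepProduct V m z k), map_one,
      one_apply_eq_self]
  calc ‖cauchyData g m‖ ≤ ‖(stepProduct V m z k)⁻¹‖ * ‖cauchyData g (m + k)‖ := by
        rw [← Matrix.l2_opNorm_toEuclideanCLM]
        exact hback ▸ ContinuousLinearMap.le_opNorm _ _
    _ ≤ _ := by gcongr; exact norm_inv_le_of_det_eq_one (det_stepProduct V m z k)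

end Solution

section BoundedEnergies

variable {S : Set ℤ} {V : S → ℝ}

/-- The energies at which the transfer matrices between sites of `S ∩ [-N, N]` are bounded by
`D`. -/
def boundedEnergies (V : S → ℝ) (N D : ℝ) : Set ℝ :=
  {E | ∀ n m : S, |((n : ℤ) : ℝ)| ≤ N → |((m : ℤ) : ℝ)| ≤ N → ‖transfer V n m (E : ℂ)‖ ≤ D}

theorem norm_stepProduct_le_of_mem_boundedEnergies {N D E : ℝ} (hE : E ∈ boundedEnergies V N D)
    {m : ℤ} {k : ℕ} (hS : Set.Icc m (m + k) ⊆ S)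
    (hN : ∀ n ∈ Set.Icc m (m + k), |(n : ℝ)| ≤ N) (z : ℂ) :
    ‖stepProduct V m z k‖ ≤ D * Real.exp (2 * N * D * ‖z - E‖) := by
  have hreal (i j : ℕ) (hij : i + j ≤ k) : ‖stepProduct V (m + i) E j‖ ≤ D := by
    have hstart : m + i ∈ Set.Icc m (m + k) := ⟨by omega, by omega⟩
    have hend : m + i + j ∈ Set.Icc m (m + k) := ⟨by omega, by omega⟩
    rw [← transfer_add_right]
    exact hE ⟨_, hS hend⟩ ⟨_, hS hstart⟩ (hN _ hend) (hN _ hstart)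
  have hD : 0 ≤ D := (norm_nonneg _).trans (hreal 0 0 (Nat.zero_le _))
  have hk : (k : ℝ) ≤ 2 * N := by
    have hstart := abs_le.1 (hN m ⟨le_rfl, by omega⟩)
    have hend := abs_le.1 (hN (m + k) ⟨by omega, le_rfl⟩)
    push_cast at hend
    linarith [hstart.1, hend.2]
  calc ‖stepProduct V m z k‖ ≤ D * (1 + D * ‖z - E‖) ^ k := norm_stepProduct_le_mul_pow V hreal z
    _ ≤ D * Real.exp (D * ‖z - E‖) ^ k := by
        gcongr
        rw [add_comm]
        exact Real.add_one_le_exp _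
    _ = D * Real.exp (k * (D * ‖z - E‖)) := by rw [Real.exp_nat_mul]
    _ ≤ D * Real.exp (2 * N * D * ‖z - E‖) := by
        rw [mul_assoc (2 * N)]
        gcongr

theorem norm_stepProduct_le_of_powerLaw {N C α E : ℝ} (hN : 0 < N)
    (hE : E ∈ boundedEnergies V N (C * N ^ α)) {m : ℤ} {k : ℕ} (hS : Set.Icc m (m + k) ⊆ S)
    (hmk : ∀ n ∈ Set.Icc m (m + k), |(n : ℝ)| ≤ N) {z : ℂ}
    (hz : ‖z - E‖ ≤ 2 / N ^ (1 + α)) :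
    ‖stepProduct V m z k‖ ≤ C * Real.exp (4 * C) * N ^ α := by
  have hC : 0 ≤ C * N ^ α := by
    have hm := hmk m ⟨le_rfl, by omega⟩
    have hmS : m ∈ S := hS ⟨le_rfl, by omega⟩
    exact (norm_nonneg _).trans (hE ⟨m, hmS⟩ ⟨m, hmS⟩ hm hm)
  have hexponent : 2 * N * (C * N ^ α) * ‖z - E‖ ≤ 4 * C :=
    calc 2 * N * (C * N ^ α) * ‖z - E‖ ≤ 2 * N * (C * N ^ α) * (2 / N ^ (1 + α)) := by gcongr
      _ = 4 * C := by
        rw [Real.rpow_add hN, Real.rpow_one]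
        field_simp
        ring
  calc ‖stepProduct V m z k‖ ≤ C * N ^ α * Real.exp (2 * N * (C * N ^ α) * ‖z - E‖) :=
        norm_stepProduct_le_of_mem_boundedEnergies hE hS hmk z
    _ ≤ C * N ^ α * Real.exp (4 * C) := by gcongr
    _ = C * Real.exp (4 * C) * N ^ α := by ring

end BoundedEnergies

section Perturbation

variable {S : Set ℤ} {V V₀ : S → ℝ} {L : ℕ}

theorem exists_zeroExt_add_eq (V₀ : S → ℝ) {W : S → ℝ} (hW : (Function.support W).Finite) :
    ∃ L : ℕ, ∀ n : ℤ, L ≤ |n| → zeroExt (V₀ + W) n = zeroExt V₀ n := by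
  obtain ⟨L, hL⟩ := (hW.image fun n : S => (n : ℤ).natAbs).bddAbove
  refine ⟨L + 1, fun n hn => ?_⟩
  by_cases hnS : n ∈ S
  · have hWn : W ⟨n, hnS⟩ = 0 := by
      by_contra h
      have hle : n.natAbs ≤ L := hL ⟨⟨n, hnS⟩, h, rfl⟩
      rw [Int.abs_eq_natAbs] at hn
      omega
    simp [zeroExt, hnS, hWn]
  · rw [zeroExt_of_notMem _ hnS, zeroExt_of_notMem _ hnS]

theorem exists_norm_cauchyData_one_le
    (hV : ∀ n : ℤ, L ≤ |n| → zeroExt V n = zeroExt V₀ n) (r : ℝ) :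
    ∃ R > 0, ∀ z ∈ Metric.closedBall (0 : ℂ) r, ∀ g, IsSolutionOn V z g (Set.Ioi 1) → ∀ k : ℕ,
      ‖cauchyData g 1‖ ≤
        R * ‖stepProduct V₀ (1 + L) z k‖ * ‖cauchyData g (1 + L + k)‖ := by
  obtain ⟨R, hR⟩ := exists_norm_stepProduct_le V 1 L r
  refine ⟨3 * max R 1, by positivity, fun z hz g hg k => ?_⟩
  have hsplit : stepProduct V 1 z (L + k) =
      stepProduct V₀ (1 + L) z k * stepProduct V 1 z L := by
    rw [stepProduct_add, stepProduct_congr fun n hn => hV n ?_]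
    rw [abs_of_nonneg] <;> linarith [hn.1]
  have hback := IsSolutionOn.norm_cauchyData_le (m := 1) (k := L + k) fun n hn => hg n hn.1
  calc ‖cauchyData g 1‖
      ≤ 3 * (‖stepProduct V₀ (1 + L) z k‖ * ‖stepProduct V 1 z L‖) *
          ‖cauchyData g (1 + L + k)‖ := by
        rw [hsplit, Nat.cast_add, ← add_assoc] at hback
        exact hback.trans (by gcongr; exact norm_mul_le _ _)
    _ ≤ 3 * (‖stepProduct V₀ (1 + L) z k‖ * max R 1) * ‖cauchyData g (1 + L + k)‖ := by
        gcongr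
        exact (hR z hz).trans (le_max_left _ _)
    _ = _ := by ring

theorem exists_norm_cauchyData_zero_le
    (hV : ∀ n : ℤ, L ≤ |n| → zeroExt V n = zeroExt V₀ n) (r : ℝ) :
    ∃ R > 0, ∀ z ∈ Metric.closedBall (0 : ℂ) r, ∀ g, IsSolutionOn V z g (Set.Iic 0) → ∀ k : ℕ,
      ‖cauchyData g 0‖ ≤
        R * ‖stepProduct V₀ (-L - k) z k‖ * ‖cauchyData g (-L - k)‖ := by
  obtain ⟨R, hR⟩ := exists_norm_stepProduct_le V (-L) L r
  refine ⟨max R 1, by positivity, fun z hz g hg k => ?_⟩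
  have hsplit : stepProduct V (-L - k) z (k + L) =
      stepProduct V (-L) z L * stepProduct V₀ (-L - k) z k := by
    rw [stepProduct_add, sub_add_cancel, stepProduct_congr (V := V) (V' := V₀) (m := -L - k)]
    intro n hn
    rw [sub_add_cancel] at hn
    exact hV n (by rw [abs_of_nonpos] <;> linarith [hn.2])
  have hend : (-L - k + (k + L : ℕ) : ℤ) = 0 := by push_cast; ring
  have hforward := IsSolutionOn.norm_cauchyData_add_le (V := V) (z := z) (m := -L - k) (k := k + L)
    fun n hn => hg n (hn.2.trans_eq hend)
  rw [hend, hsplit] at hforward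
  calc ‖cauchyData g 0‖
      ≤ ‖stepProduct V (-L) z L‖ * ‖stepProduct V₀ (-L - k) z k‖ * ‖cauchyData g (-L - k)‖ :=
        hforward.trans (by gcongr; exact norm_mul_le _ _)
    _ ≤ _ := by
        gcongr
        exact (hR z hz).trans (le_max_left _ _)

end Perturbation

section Mass

variable {S : Set ℤ} {V V₀ : S → ℝ}

theorem zeroExt_green_recurrence (V : S → ℝ) {z : ℂ} (hz : 0 < z.im) {n : ℤ} (hn : n ∈ S) :
    zeroExt (green V z) (n - 1) + zeroExt (green V z) (n + 1) +
      (zeroExt V n : ℝ) * zeroExt (green V z) n - z * zeroExt (green V z) n =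
        if n = 1 then -Complex.I else 0 := by
  have h := formalH_green V hz ⟨n, hn⟩
  rwa [formalH, ← zeroExt_coe V, ← zeroExt_coe (green V z)] at h

theorem isSolutionOn_green (V : S → ℝ) {z : ℂ} (hz : 0 < z.im) :
    IsSolutionOn V z (zeroExt (green V z)) (S \ {1}) := fun _ hn =>
  sub_eq_zero.1 ((zeroExt_green_recurrence V hz hn.1).trans (if_neg hn.2))

theorem exists_le_norm_cauchyData_green (V : S → ℝ) (h1 : 1 ∈ S) (r : ℝ) :
    ∃ ε > 0, ∀ z ∈ Metric.closedBall (0 : ℂ) r, 0 < z.im →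
      ε ≤ ‖cauchyData (zeroExt (green V z)) 1‖ ∨
        0 ∈ S ∧ ε ≤ ‖cauchyData (zeroExt (green V z)) 0‖ := by
  obtain ⟨M, hM⟩ := exists_norm_stepProduct_le V 0 1 r
  refine ⟨(1 + max M 0)⁻¹, by positivity, fun z hz him => ?_⟩
  set g := zeroExt (green V z) with hg
  have hsource : 1 ≤ ‖cauchyData g 1‖ + max M 0 * ‖cauchyData g 0‖ := by
    have h := norm_source_le V z g 1
    rw [hg, zeroExt_green_recurrence V him h1, if_pos rfl, norm_neg, Complex.norm_I, sub_self] at h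
    refine h.trans ?_
    gcongr
    have hstep := hM z hz
    rw [stepProduct_one, zero_add] at hstep
    exact hstep.trans (le_max_left _ _)
  rw [inv_le_iff_one_le_mul₀ (by positivity), inv_le_iff_one_le_mul₀ (by positivity)]
  by_cases h0 : 0 ∈ S
  · by_contra! h
    nlinarith [h.1, h.2 h0, le_max_right M 0]
  · have hle : ‖cauchyData g 0‖ ≤ ‖cauchyData g 1‖ := by
      refine (sq_le_sq₀ (norm_nonneg _) (norm_nonneg _)).1 ?_
      rw [norm_cauchyData_sq, norm_cauchyData_sq, hg, zeroExt_of_notMem _ h0]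
      simp
    left
    nlinarith [mul_le_mul_of_nonneg_left hle (le_max_right M 0)]

theorem exists_norm_cauchyData_one_le_of_powerLaw (hS : Set.Ici 1 ⊆ S) {L : ℕ}
    (hV : ∀ n : ℤ, L ≤ |n| → zeroExt V n = zeroExt V₀ n) {C : ℝ} (hC : 0 < C) (α r : ℝ) :
    ∃ R > 0, ∀ N > 0, ∀ E ∈ boundedEnergies V₀ N (C * N ^ α),
      ∀ z ∈ Metric.closedBall (0 : ℂ) r, ‖z - E‖ ≤ 2 / N ^ (1 + α) →
        ∀ g, IsSolutionOn V z g (Set.Ioi 1) → ∀ n : ℤ, 1 + L ≤ n → n ≤ N →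
          ‖cauchyData g 1‖ ≤ R * N ^ α * ‖cauchyData g n‖ := by
  obtain ⟨R, hR0, hR⟩ := exists_norm_cauchyData_one_le hV r
  refine ⟨R * (C * Real.exp (4 * C)), by positivity, fun N hN E hE z hz hzE g hg n hLn hnN => ?_⟩
  obtain ⟨k, rfl⟩ := Int.le.dest hLn
  refine (hR z hz g hg k).trans ?_
  rw [mul_assoc R (C * Real.exp (4 * C))]
  gcongr
  refine norm_stepProduct_le_of_powerLaw hN hE (fun j hj => hS ?_) (fun j hj => ?_) hzE
  · rw [Set.mem_Ici]; linarith [hj.1]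
  · rw [abs_of_nonneg (by exact_mod_cast (by linarith [hj.1] : 0 ≤ j))]
    exact (Int.cast_le.2 hj.2).trans hnN

theorem exists_norm_cauchyData_zero_le_of_powerLaw {L : ℕ}
    (hV : ∀ n : ℤ, L ≤ |n| → zeroExt V n = zeroExt V₀ n) {C : ℝ} (hC : 0 < C) (α r : ℝ) :
    ∃ R > 0, Set.Iic 0 ⊆ S → ∀ N > 0, ∀ E ∈ boundedEnergies V₀ N (C * N ^ α),
      ∀ z ∈ Metric.closedBall (0 : ℂ) r, ‖z - E‖ ≤ 2 / N ^ (1 + α) →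
        ∀ g, IsSolutionOn V z g (Set.Iic 0) → ∀ n : ℤ, n ≤ -L → -N ≤ n →
          ‖cauchyData g 0‖ ≤ R * N ^ α * ‖cauchyData g n‖ := by
  obtain ⟨R, hR0, hR⟩ := exists_norm_cauchyData_zero_le hV r
  refine ⟨R * (C * Real.exp (4 * C)), by positivity, fun hS N hN E hE z hz hzE g hg n hnL hNn => ?_⟩
  obtain ⟨k, hk⟩ := Int.le.dest hnL
  obtain rfl : n = -L - k := by linarith
  refine (hR z hz g hg k).trans ?_
  rw [mul_assoc R (C * Real.exp (4 * C))]
  gcongr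
  refine norm_stepProduct_le_of_powerLaw hN hE (fun j hj => hS ?_) (fun j hj => ?_) hzE
  · rw [Set.mem_Iic]; linarith [hj.2]
  · rw [abs_of_nonpos (by exact_mod_cast (by linarith [hj.2] : j ≤ 0))]
    linarith [(Int.cast_le (R := ℝ)).2 hj.1]

theorem sum_enorm_zeroExt_sq_le_tsum (u : S → ℂ) {a : ℝ} {s : Finset ℤ}
    (hs : ∀ k ∈ s, a ≤ |(k : ℝ)|) :
    ∑ k ∈ s, ‖zeroExt u k‖ₑ ^ 2 ≤ ∑' n : {n : S // a ≤ |((n : ℤ) : ℝ)|}, ‖u n.1‖ₑ ^ 2 := by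
  have hinj : Function.Injective fun n : {n : S // a ≤ |((n : ℤ) : ℝ)|} => ((n : S) : ℤ) :=
    Subtype.val_injective.comp Subtype.val_injective
  have hsupp : Function.support ((s : Set ℤ).indicator fun k => ‖zeroExt u k‖ₑ ^ 2) ⊆
      Set.range fun n : {n : S // a ≤ |((n : ℤ) : ℝ)|} => ((n : S) : ℤ) := by
    intro k hk
    rw [Set.support_indicator] at hk
    by_cases hkS : k ∈ S
    · exact ⟨⟨⟨k, hkS⟩, hs k hk.1⟩, rfl⟩
    · exact absurd (by simp [zeroExt_of_notMem u hkS]) hk.2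
  rw [← Finset.tsum_subtype',
    tsum_subtype (s : Set ℤ) (fun k => ‖zeroExt u k‖ₑ ^ 2), ← hinj.tsum_eq hsupp]
  refine ENNReal.tsum_le_tsum fun n => ?_
  rw [← zeroExt_coe u n.1]
  exact Set.indicator_le_self _ _ _

theorem card_mul_le_tsum_enorm_sq (u : S → ℂ) {a c : ℝ} (hc : 0 ≤ c) {J : Finset ℤ}
    (ha : ∀ j ∈ J, a ≤ |(j : ℝ)| ∧ a ≤ |((j + 1 : ℤ) : ℝ)|)
    (hJ : ∀ j ∈ J, c ≤ ‖cauchyData (zeroExt u) j‖) :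
    J.card * ENNReal.ofReal (c ^ 2) ≤
      2 * ∑' n : {n : S // a ≤ |((n : ℤ) : ℝ)|}, ‖u n.1‖ₑ ^ 2 := by
  have hterm : ∀ j ∈ J,
      ENNReal.ofReal (c ^ 2) ≤ ‖zeroExt u (j + 1)‖ₑ ^ 2 + ‖zeroExt u j‖ₑ ^ 2 := fun j hj => by
    rw [← ofReal_norm, ← ofReal_norm, ← ENNReal.ofReal_pow (norm_nonneg _),
      ← ENNReal.ofReal_pow (norm_nonneg _), ← ENNReal.ofReal_add (by positivity) (by positivity),
      ← norm_cauchyData_sq]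
    gcongr
    exact hJ j hj
  calc J.card * ENNReal.ofReal (c ^ 2)
      ≤ ∑ j ∈ J, (‖zeroExt u (j + 1)‖ₑ ^ 2 + ‖zeroExt u j‖ₑ ^ 2) := by
        rw [← nsmul_eq_mul]
        exact J.card_nsmul_le_sum _ _ hterm
    _ = ∑ k ∈ J.map (addRightEmbedding 1), ‖zeroExt u k‖ₑ ^ 2 + ∑ k ∈ J, ‖zeroExt u k‖ₑ ^ 2 := by
        rw [Finset.sum_add_distrib, Finset.sum_map]
        rfl
    _ ≤ _ := by
        rw [two_mul]
        gcongr
        · refine sum_enorm_zeroExt_sq_le_tsum u fun k hk => ?_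
          obtain ⟨j, hj, rfl⟩ := Finset.mem_map.1 hk
          exact (ha j hj).2
        · exact sum_enorm_zeroExt_sq_le_tsum u fun k hk => (ha k hk).1

theorem exists_finset_quarter_le_card {N : ℝ} (hN : 8 ≤ N) :
    ∃ J : Finset ℤ, N / 4 ≤ J.card ∧ ∀ j ∈ J, N / 2 ≤ j ∧ (j : ℝ) + 1 ≤ N := by
  refine ⟨Finset.Icc ⌈N / 2⌉ (⌊N⌋ - 1), ?_, fun j hj => ?_⟩
  · have hcard : ⌊N⌋ - ⌈N / 2⌉ ≤ (Finset.Icc ⌈N / 2⌉ (⌊N⌋ - 1)).card := by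
      rw [Int.card_Icc, sub_add_cancel]
      exact Int.self_le_toNat _
    have hcard' := (Int.cast_le (R := ℝ)).2 hcard
    push_cast at hcard'
    linarith [Int.sub_one_lt_floor N, Int.ceil_lt_add_one (N / 2)]
  · obtain ⟨hle, hge⟩ := Finset.mem_Icc.1 hj
    exact ⟨Int.ceil_le.1 hle, by exact_mod_cast Int.le_floor.1 (by linarith : j + 1 ≤ ⌊N⌋)⟩

theorem exists_finset_le_norm_cauchyData_green (hIci : Set.Ici 1 ⊆ S)
    (hIic : 0 ∈ S → Set.Iic 0 ⊆ S) {L : ℕ}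
    (hV : ∀ n : ℤ, L ≤ |n| → zeroExt V n = zeroExt V₀ n) {C : ℝ} (hC : 0 < C) (α r : ℝ) :
    ∃ c > 0, ∀ᶠ N : ℝ in atTop, ∀ E ∈ boundedEnergies V₀ N (C * N ^ α),
      ∀ z ∈ Metric.closedBall (0 : ℂ) r, 0 < z.im → ‖z - E‖ ≤ 2 / N ^ (1 + α) →
        ∃ J : Finset ℤ, N / 4 ≤ J.card ∧
          (∀ j ∈ J, N / 2 ≤ |(j : ℝ)| ∧ N / 2 ≤ |((j + 1 : ℤ) : ℝ)|) ∧
          ∀ j ∈ J, c / N ^ α ≤ ‖cauchyData (zeroExt (green V z)) j‖ := by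
  obtain ⟨ε, hε, hsource⟩ := exists_le_norm_cauchyData_green V (hIci (Set.mem_Ici.2 le_rfl)) r
  obtain ⟨R, hR, hright⟩ := exists_norm_cauchyData_one_le_of_powerLaw hIci hV hC α r
  obtain ⟨R', hR', hleft⟩ := exists_norm_cauchyData_zero_le_of_powerLaw hV hC α r
  refine ⟨ε / (R + R'), by positivity, ?_⟩
  filter_upwards [eventually_ge_atTop 8, eventually_ge_atTop (2 * (L + 1 : ℝ))]
    with N hN8 hNL E hE z hz him hzE
  have hN0 : 0 < N := by linarith
  have hgreen := isSolutionOn_green V him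
  have hlower {x y R₁ : ℝ} (hx : ε ≤ x) (hR₁ : R₁ ≤ R + R') (hy : 0 ≤ y)
      (hxy : x ≤ R₁ * N ^ α * y) : ε / (R + R') / N ^ α ≤ y := by
    rw [div_div, div_le_iff₀' (by positivity)]
    exact (hx.trans hxy).trans (by gcongr)
  obtain ⟨J, hcard, hJ⟩ := exists_finset_quarter_le_card hN8
  rcases hsource z hz him with h1 | ⟨h0, h1⟩
  · refine ⟨J, hcard, fun j hj => ?_, fun j hj => ?_⟩ <;> obtain ⟨hle, hge⟩ := hJ j hj
    · push_cast
      exact ⟨hle.trans (le_abs_self _), le_trans (by linarith) (le_abs_self _)⟩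
    · exact hlower h1 (by linarith) (norm_nonneg _) (hright N hN0 E hE z hz hzE _
        (fun n hn => hgreen n ⟨hIci (Set.mem_Ici.2 hn.le), hn.ne'⟩) j
        (by exact_mod_cast (by linarith : (1 + L : ℝ) ≤ j)) (by linarith))
  · have hneg (j : ℤ) : ((Equiv.addRight 1).trans (Equiv.neg ℤ)).toEmbedding j = -(j + 1) := rfl
    refine ⟨J.map ((Equiv.addRight 1).trans (Equiv.neg ℤ)).toEmbedding, by rwa [Finset.card_map],
      ?_, ?_⟩ <;>
      simp only [Finset.forall_mem_map, hneg] <;> intro j hj <;> obtain ⟨hle, hge⟩ := hJ j hj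
    · push_cast
      exact ⟨le_trans (by linarith) (neg_le_abs _), le_trans (by linarith) (neg_le_abs _)⟩
    · refine hlower h1 (by linarith) (norm_nonneg _) (hleft (hIic h0) N hN0 E hE z hz hzE _
        (fun n hn => hgreen n ⟨hIic h0 hn, fun h => by simp_all⟩) _
        (neg_le_neg (by exact_mod_cast (by linarith : (L : ℝ) ≤ j + 1))) ?_)
      push_cast
      linarith

theorem exists_le_tsum_enorm_green_sq (hIci : Set.Ici 1 ⊆ S) (hIic : 0 ∈ S → Set.Iic 0 ⊆ S)
    (V₀ : S → ℝ) {W : S → ℝ} (hW : (Function.support W).Finite) {C α : ℝ} (hC : 0 < C)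
    (hα : 0 ≤ α) (K : ℝ) :
    ∃ c > 0, ∀ᶠ N : ℝ in atTop, ∀ E ∈ Set.Icc (-K) K ∩ boundedEnergies V₀ N (C * N ^ α),
      ∀ z : ℂ, 0 < z.im → ‖z - E‖ ≤ 2 / N ^ (1 + α) →
        ENNReal.ofReal (c * N ^ (1 - 2 * α)) ≤
          ∑' n : {n : S // N / 2 ≤ |((n : ℤ) : ℝ)|}, ‖green (V₀ + W) z n.1‖ₑ ^ 2 := by
  obtain ⟨L, hL⟩ := exists_zeroExt_add_eq V₀ hW
  obtain ⟨c, hc, hsites⟩ :=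
    exists_finset_le_norm_cauchyData_green hIci hIic hL hC α (K + 2)
  refine ⟨c ^ 2 / 8, by positivity, ?_⟩
  filter_upwards [hsites, eventually_ge_atTop 1] with N hsitesN hN1 E hE z him hz
  have hN0 : 0 < N := by linarith
  have hzr : z ∈ Metric.closedBall (0 : ℂ) (K + 2) := by
    have hpow : 2 / N ^ (1 + α) ≤ 2 :=
      div_le_self (by norm_num) (Real.one_le_rpow hN1 (by linarith))
    have hEK : ‖(E : ℂ)‖ ≤ K := by simpa using abs_le.2 hE.1
    rw [mem_closedBall_zero_iff]
    linarith [norm_le_norm_add_norm_sub' z (E : ℂ)]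
  obtain ⟨J, hcard, hJN, hJc⟩ := hsitesN E hE.2 z hzr him hz
  have hmass := card_mul_le_tsum_enorm_sq (green (V₀ + W) z) (by positivity) hJN hJc
  rw [← ENNReal.mul_le_mul_iff_right two_ne_zero ENNReal.ofNat_ne_top]
  refine le_trans ?_ hmass
  rw [← ENNReal.ofReal_ofNat, ← ENNReal.ofReal_natCast, ← ENNReal.ofReal_mul (by norm_num),
    ← ENNReal.ofReal_mul (by positivity)]
  refine ENNReal.ofReal_le_ofReal ?_
  calc 2 * (c ^ 2 / 8 * N ^ (1 - 2 * α)) = N / 4 * (c / N ^ α) ^ 2 := by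
        rw [Real.rpow_sub hN0, Real.rpow_one, two_mul α, Real.rpow_add hN0]
        field_simp
        norm_num
    _ ≤ J.card * (c / N ^ α) ^ 2 := by gcongr

end Mass

section Dynamics

variable {S : Set ℤ}

/-- The time-averaged probability `∑_{|n| ≥ N} a(n, T)` of being at distance at least `N` from the
origin. -/
noncomputable def outsideProbability (V : S → ℝ) (N T : ℝ) : ℝ≥0∞ :=
  ∑' n : {n : S // N ≤ |((n : ℤ) : ℝ)|}, timeAverage V n.1 T

theorem measurable_enorm_green_sq (V : S → ℝ) {η : ℝ} (hη : 0 < η) (n : S) :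
    Measurable fun x : ℝ => ‖green V (x + η * Complex.I) n‖ₑ ^ 2 :=
  (continuous_green_horizontal V hη n).enorm.measurable.pow_const 2

theorem outsideProbability_eq_lintegral_green (V : S → ℝ) (N : ℝ) {T : ℝ} (hT : 0 < T) :
    outsideProbability V N T = ENNReal.ofReal (2 * Real.pi * T)⁻¹ *
      ∫⁻ x : ℝ, ∑' n : {n : S // N ≤ |((n : ℤ) : ℝ)|},
        ‖green V (x + (T⁻¹ : ℝ) * Complex.I) n.1‖ₑ ^ 2 := by
  rw [lintegral_tsum (f := fun (n : {n : S // N ≤ |((n : ℤ) : ℝ)|}) (x : ℝ) =>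
      ‖green V (x + (T⁻¹ : ℝ) * Complex.I) n.1‖ₑ ^ 2)
      fun n => (measurable_enorm_green_sq V (inv_pos.2 hT) n.1).aemeasurable,
    ← ENNReal.tsum_mul_left]
  exact tsum_congr fun n => timeAverage_eq_lintegral_green V n.1 hT

theorem mul_volume_le_outsideProbability (V : S → ℝ) {N T : ℝ} (hT : 0 < T) {b : ℝ≥0∞} {B : Set ℝ}
    (hB : ∀ x ∈ B, b ≤ ∑' n : {n : S // N ≤ |((n : ℤ) : ℝ)|},
      ‖green V (x + (T⁻¹ : ℝ) * Complex.I) n.1‖ₑ ^ 2) :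
    ENNReal.ofReal (2 * Real.pi * T)⁻¹ * (b * volume B) ≤ outsideProbability V N T := by
  rw [outsideProbability_eq_lintegral_green V N hT, ← setLIntegral_const B b]
  gcongr ENNReal.ofReal (2 * Real.pi * T)⁻¹ * ?_
  refine (setLIntegral_mono ?_ hB).trans (setLIntegral_le_lintegral _ _)
  exact .tsum fun n => measurable_enorm_green_sq V (inv_pos.2 hT) n.1

theorem ofReal_rpow_mul_outsideProbability_le_moment (V : S → ℝ) {p N : ℝ} (hp : 0 ≤ p)
    (hN : 0 ≤ N) (T : ℝ) :
    ENNReal.ofReal (N ^ p) * outsideProbability V N T ≤ moment V p T := by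
  rw [outsideProbability, ← ENNReal.tsum_mul_left]
  refine le_trans (ENNReal.tsum_le_tsum fun n => ?_)
    (ENNReal.tsum_comp_le_tsum_of_injective Subtype.val_injective _)
  have hn := n.2
  gcongr

theorem scale_pos (α : ℝ) {T : ℝ} (hT : 0 < T) : 0 < scale α T := Real.rpow_pos_of_pos hT _

theorem scale_rpow {α T : ℝ} (hα : 0 ≤ α) (hT : 0 ≤ T) : scale α T ^ (1 + α) = T := by
  rw [scale, ← Real.rpow_mul hT, one_div_mul_cancel (by positivity), Real.rpow_one]

theorem tendsto_scale {α : ℝ} (hα : 0 ≤ α) : Tendsto (scale α) atTop atTop :=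
  tendsto_rpow_atTop (by positivity)

theorem norm_add_inv_mul_I_sub_le {x E T : ℝ} (hT : 0 < T) (h : |x - E| ≤ 1 / T) :
    ‖(x + (T⁻¹ : ℝ) * Complex.I : ℂ) - E‖ ≤ 2 / T := by
  calc ‖(x + (T⁻¹ : ℝ) * Complex.I : ℂ) - E‖
      = ‖((x - E : ℝ) : ℂ) + (T⁻¹ : ℝ) * Complex.I‖ := by push_cast; ring_nf
    _ ≤ |x - E| + T⁻¹ := by
        refine (norm_add_le _ _).trans_eq ?_
        rw [norm_mul, Complex.norm_I, mul_one, Complex.norm_real, Complex.norm_real,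
          Real.norm_eq_abs, Real.norm_of_nonneg (by positivity)]
    _ ≤ 1 / T + 1 / T := by gcongr; exact (one_div T).ge
    _ = 2 / T := by ring

theorem exists_mul_volume_le_outsideProbability (hIci : Set.Ici 1 ⊆ S)
    (hIic : 0 ∈ S → Set.Iic 0 ⊆ S) {V₀ W : S → ℝ} (hW : (Function.support W).Finite)
    {K C α : ℝ} (hC : 0 < C) (hα : 0 ≤ α) {A : ℝ → Set ℝ}
    (hA : ∀ᶠ N in atTop, A N ⊆ Set.Icc (-K) K ∩ boundedEnergies V₀ N (C * N ^ α)) :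
    ∃ c > 0, ∀ᶠ T in atTop,
      ENNReal.ofReal (c / T * scale α T ^ (1 - 2 * α)) * volume (energyNhd A α T) ≤
        outsideProbability (V₀ + W) (scale α T / 2) T := by
  obtain ⟨c, hc, hmass⟩ := exists_le_tsum_enorm_green_sq hIci hIic V₀ hW hC hα K
  refine ⟨c / (2 * Real.pi), by positivity, ?_⟩
  filter_upwards [(tendsto_scale hα).eventually hmass, (tendsto_scale hα).eventually hA,
    eventually_gt_atTop 0] with T hmassT hAT hT
  refine le_of_eq_of_le ?_ (mul_volume_le_outsideProbability (V₀ + W) hT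
    (b := ENNReal.ofReal (c * scale α T ^ (1 - 2 * α))) (B := energyNhd A α T) ?_)
  · rw [← mul_assoc, ← ENNReal.ofReal_mul (by positivity)]
    congr 2
    field_simp
  · rintro x ⟨E, hE, hxE⟩
    refine hmassT E (hAT hE) _ (by simpa using hT) ?_
    rw [scale_rpow hα hT.le]
    exact norm_add_inv_mul_I_sub_le hT hxE

theorem mul_le_moment_of_le_outsideProbability {V : S → ℝ} {p N T a r : ℝ} (hp : 0 ≤ p)
    (hN : 0 < N) {v : ℝ≥0∞}
    (h : ENNReal.ofReal (a * N ^ r) * v ≤ outsideProbability V (N / 2) T) :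
    ENNReal.ofReal (a / 2 ^ p * N ^ (p + r)) * v ≤ moment V p T := by
  refine le_trans ?_ (ofReal_rpow_mul_outsideProbability_le_moment V hp (half_pos hN).le T)
  calc ENNReal.ofReal (a / 2 ^ p * N ^ (p + r)) * v
      = ENNReal.ofReal ((N / 2) ^ p) * (ENNReal.ofReal (a * N ^ r) * v) := by
        rw [← mul_assoc, ← ENNReal.ofReal_mul (by positivity), Real.div_rpow hN.le (by norm_num),
          Real.rpow_add hN]
        congr 2
        field_simp
    _ ≤ _ := by gcongr

theorem exists_lower_bounds_of_powerLaw (hIci : Set.Ici 1 ⊆ S)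
    (hIic : 0 ∈ S → Set.Iic 0 ⊆ S) {V₀ W : S → ℝ} (hW : (Function.support W).Finite)
    {K C α : ℝ} (hC : 0 < C) (hα : 0 ≤ α) {A : ℝ → Set ℝ}
    (hA : ∀ᶠ N in atTop, A N ⊆ Set.Icc (-K) K ∩ boundedEnergies V₀ N (C * N ^ α)) :
    ∃ T₀ : ℝ, 1 < T₀ ∧
      (∃ c : ℝ, 0 < c ∧ ∀ T : ℝ, T₀ ≤ T →
        ENNReal.ofReal (c / T * scale α T ^ (1 - 2 * α)) * volume (energyNhd A α T) ≤
          outsideProbability (V₀ + W) (scale α T / 2) T) ∧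
      ∀ p : ℝ, 0 ≤ p → ∃ c : ℝ, 0 < c ∧ ∀ T : ℝ, T₀ ≤ T →
        ENNReal.ofReal (c / T * scale α T ^ (p + 1 - 2 * α)) * volume (energyNhd A α T) ≤
          moment (V₀ + W) p T := by
  obtain ⟨c, hc, hout⟩ := exists_mul_volume_le_outsideProbability hIci hIic hW hC hα hA
  obtain ⟨T₁, hT₁⟩ := eventually_atTop.1 hout
  refine ⟨max T₁ 2, lt_max_of_lt_right one_lt_two,
    ⟨c, hc, fun T hT => hT₁ T ((le_max_left _ _).trans hT)⟩,
    fun p hp => ⟨c / 2 ^ p, by positivity, fun T hT => ?_⟩⟩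
  have hT0 : 0 < T := by linarith [(le_max_right T₁ 2).trans hT]
  rw [add_sub_assoc, div_right_comm]
  exact mul_le_moment_of_le_outsideProbability hp (scale_pos α hT0)
    (hT₁ T ((le_max_left _ _).trans hT))

end Dynamics

section Exponents

variable {S : Set ℤ}

theorem le_betaMinus {V : S → ℝ} {p s c : ℝ} (hc : 0 < c)
    (h : ∀ᶠ T : ℝ in atTop, ENNReal.ofReal (c * T ^ s) ≤ moment V p T) :
    (s : EReal) ≤ betaMinus V p := by
  have hlim : Tendsto (fun T : ℝ => (((Real.log c / Real.log T + s : ℝ)) : EReal)) atTop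
      (𝓝 (s : EReal)) := by
    refine (continuous_coe_real_ereal.tendsto s).comp ?_
    simpa using (Real.tendsto_log_atTop.const_div_atTop (Real.log c)).add_const s
  rw [← hlim.liminf_eq]
  refine liminf_le_liminf ?_
  filter_upwards [h, eventually_gt_atTop 1] with T hT hT1
  have hlog : 0 < Real.log T := Real.log_pos hT1
  have hT0 : 0 < T := by linarith
  have hquot : Real.log c / Real.log T + s = Real.log (c * T ^ s) / Real.log T := by
    rw [Real.log_mul hc.ne' (Real.rpow_pos_of_pos hT0 s).ne', Real.log_rpow hT0]
    field_simp
  rw [hquot, EReal.coe_div, ← ENNReal.log_ofReal_of_pos (by positivity)]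
  exact EReal.div_le_div_right_of_nonneg (by exact_mod_cast hlog.le) (ENNReal.log_monotone hT)

theorem le_betaMinus_of_powerLaw (hIci : Set.Ici 1 ⊆ S) (hIic : 0 ∈ S → Set.Iic 0 ⊆ S)
    {V₀ W : S → ℝ} (hW : (Function.support W).Finite) {K C α : ℝ} (hC : 0 < C) (hα : 0 ≤ α)
    {A : ℝ → Set ℝ}
    (hA : ∀ᶠ N in atTop, A N ⊆ Set.Icc (-K) K ∩ boundedEnergies V₀ N (C * N ^ α)) {b q : ℝ}
    (hb : 0 < b)
    (hvol : ∀ᶠ T in atTop, ENNReal.ofReal (b * T ^ q) ≤ volume (energyNhd A α T)) {p : ℝ}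
    (hp : 0 ≤ p) :
    (((p + 1 - 2 * α) / (1 + α) - 1 + q : ℝ) : EReal) ≤ betaMinus (V₀ + W) p := by
  obtain ⟨T₀, hT₀, -, hmoment⟩ := exists_lower_bounds_of_powerLaw hIci hIic hW hC hα hA
  obtain ⟨c, hc, hmoment⟩ := hmoment p hp
  refine le_betaMinus (mul_pos hc hb) ?_
  filter_upwards [hvol, eventually_ge_atTop T₀] with T hv hT
  have hT0 : 0 < T := by linarith
  have hscale := scale_pos α hT0
  calc ENNReal.ofReal (c * b * T ^ ((p + 1 - 2 * α) / (1 + α) - 1 + q))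
      = ENNReal.ofReal (c / T * scale α T ^ (p + 1 - 2 * α)) * ENNReal.ofReal (b * T ^ q) := by
        rw [← ENNReal.ofReal_mul (by positivity), scale, ← Real.rpow_mul hT0.le,
          Real.rpow_add hT0, Real.rpow_sub hT0, Real.rpow_one, one_div_mul_eq_div]
        congr 1
        ring
    _ ≤ ENNReal.ofReal (c / T * scale α T ^ (p + 1 - 2 * α)) * volume (energyNhd A α T) := by
        gcongr
    _ ≤ moment (V₀ + W) p T := hmoment T hT

theorem mem_boundedEnergies_of_norm_transfer_le_rpow {V : S → ℝ} {E₀ C α : ℝ} (hα : 0 ≤ α)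
    (h : ∀ n m : S, ((n : ℤ), (m : ℤ)) ≠ (0, 0) →
      ‖transfer V n m (E₀ : ℂ)‖ ≤ C * (|((n : ℤ) : ℝ)| + |((m : ℤ) : ℝ)|) ^ α)
    {N : ℝ} (hN : 1 ≤ N) : E₀ ∈ boundedEnergies V N (max C 1 * 2 ^ α * N ^ α) := by
  intro n m hn hm
  rw [mul_assoc, ← Real.mul_rpow (by norm_num) (by linarith)]
  by_cases h0 : ((n : ℤ), (m : ℤ)) = (0, 0)
  · obtain ⟨hn0, hm0⟩ := Prod.mk.inj h0
    have hid : transfer V 0 0 (E₀ : ℂ) = 1 := by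
      simpa [stepProduct] using transfer_add_right V 0 0 (E₀ : ℂ)
    rw [hn0, hm0, hid, CStarRing.norm_one]
    exact one_le_mul_of_one_le_of_one_le (le_max_right _ _) (Real.one_le_rpow (by linarith) hα)
  · refine (h n m h0).trans ?_
    gcongr
    · exact le_max_left _ _
    · linarith

theorem le_betaMinus_of_norm_transfer_le_rpow (hIci : Set.Ici 1 ⊆ S)
    (hIic : 0 ∈ S → Set.Iic 0 ⊆ S) {V₀ W : S → ℝ} (hW : (Function.support W).Finite)
    {E₀ C α : ℝ} (hα : 0 ≤ α)
    (h : ∀ n m : S, ((n : ℤ), (m : ℤ)) ≠ (0, 0) →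
      ‖transfer V₀ n m (E₀ : ℂ)‖ ≤ C * (|((n : ℤ) : ℝ)| + |((m : ℤ) : ℝ)|) ^ α)
    {p : ℝ} (hp : 0 ≤ p) :
    (((p - 1 - 4 * α) / (1 + α) : ℝ) : EReal) ≤ betaMinus (V₀ + W) p := by
  have hA : ∀ᶠ N in atTop,
      {E₀} ⊆ Set.Icc (-|E₀|) |E₀| ∩ boundedEnergies V₀ N (max C 1 * 2 ^ α * N ^ α) := by
    filter_upwards [eventually_ge_atTop 1] with N hN
    exact Set.singleton_subset_iff.2
      ⟨abs_le.1 le_rfl, mem_boundedEnergies_of_norm_transfer_le_rpow hα h hN⟩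
  have hvol (T : ℝ) :
      ENNReal.ofReal (2 * T ^ (-1 : ℝ)) ≤ volume (energyNhd (fun _ => {E₀}) α T) := by
    rw [Real.rpow_neg_one, ← one_div, ← Real.volume_closedBall]
    exact measure_mono fun E hE => ⟨E₀, rfl, hE⟩
  convert le_betaMinus_of_powerLaw hIci hIic hW (by positivity) hα hA two_pos (.of_forall hvol) hp
    using 2
  field_simp
  ring

theorem exists_norm_transfer_one_le {V : S → ℝ} {C E₀ θ : ℝ}
    (h : ∀ (n : S) (E : ℝ), (n : ℤ) ≠ 0 → |((n : ℤ) : ℝ)| * |E - E₀| ^ θ ≤ 1 →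
      ‖transfer V n 1 (E : ℂ)‖ ≤ C) :
    ∃ D > 0, ∀ (n : S) (E : ℝ), |E - E₀| ≤ 1 → |((n : ℤ) : ℝ)| * |E - E₀| ^ θ ≤ 1 →
      ‖transfer V n 1 (E : ℂ)‖ ≤ D := by
  obtain ⟨M, hM⟩ := exists_norm_stepProduct_le V 0 1 (|E₀| + 1)
  refine ⟨max 1 (max C (3 * M)), by positivity, fun n E hE hnE => ?_⟩
  by_cases hn : (n : ℤ) = 0
  · have hEr : (E : ℂ) ∈ Metric.closedBall 0 (|E₀| + 1) := by
      rw [mem_closedBall_zero_iff, Complex.norm_real, Real.norm_eq_abs]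
      linarith [abs_sub_abs_le_abs_sub E E₀]
    have hstep : transfer V 1 0 (E : ℂ) = stepProduct V 0 E 1 := by
      simpa using transfer_add_right V 0 1 (E : ℂ)
    have hM' : 3 * ‖transfer V 1 0 (E : ℂ)‖ ≤ 3 * M := by rw [hstep]; gcongr; exact hM _ hEr
    rw [hn]
    exact (norm_transfer_symm_le V 0 1 E).trans
      (hM'.trans ((le_max_right _ _).trans (le_max_right _ _)))
  · exact (h n E hn hnE).trans ((le_max_left _ _).trans (le_max_right _ _))

theorem exists_closedBall_subset_boundedEnergies {V : S → ℝ} {C E₀ θ : ℝ} (hθ : 0 < θ)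
    (h : ∀ (n : S) (E : ℝ), (n : ℤ) ≠ 0 → |((n : ℤ) : ℝ)| * |E - E₀| ^ θ ≤ 1 →
      ‖transfer V n 1 (E : ℂ)‖ ≤ C) :
    ∃ D > 0, ∀ N ≥ 1, Metric.closedBall E₀ (N ^ (-(1 / θ))) ⊆
      Set.Icc (-(|E₀| + 1)) (|E₀| + 1) ∩ boundedEnergies V N D := by
  obtain ⟨D, hD, hone⟩ := exists_norm_transfer_one_le h
  refine ⟨D * (3 * D), by positivity, fun N hN E hE => ?_⟩
  rw [Metric.mem_closedBall, Real.dist_eq] at hE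
  have hN0 : 0 < N := by linarith
  have hE1 : |E - E₀| ≤ 1 :=
    hE.trans (Real.rpow_le_one_of_one_le_of_nonpos hN (neg_nonpos.2 (by positivity)))
  have hsite (n : S) (hn : |((n : ℤ) : ℝ)| ≤ N) : ‖transfer V n 1 (E : ℂ)‖ ≤ D := by
    refine hone n E hE1 ?_
    calc |((n : ℤ) : ℝ)| * |E - E₀| ^ θ ≤ N * (N ^ (-(1 / θ))) ^ θ := by gcongr
      _ = 1 := by
        rw [← Real.rpow_mul hN0.le, neg_mul, one_div_mul_cancel hθ.ne', Real.rpow_neg_one,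
          mul_inv_cancel₀ hN0.ne']
  refine ⟨abs_le.1 (by linarith [abs_sub_abs_le_abs_sub E E₀]), fun n m hn hm => ?_⟩
  have hn1 := hsite n hn
  have hm1 := hsite m hm
  exact (norm_transfer_le_mul V n 1 m E).trans (by gcongr)

theorem le_betaMinus_of_norm_transfer_one_le (hIci : Set.Ici 1 ⊆ S)
    (hIic : 0 ∈ S → Set.Iic 0 ⊆ S) {V₀ W : S → ℝ} (hW : (Function.support W).Finite)
    {C E₀ θ : ℝ} (hθ : 0 < θ)
    (h : ∀ (n : S) (E : ℝ), (n : ℤ) ≠ 0 → |((n : ℤ) : ℝ)| * |E - E₀| ^ θ ≤ 1 →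
      ‖transfer V₀ n 1 (E : ℂ)‖ ≤ C)
    {p : ℝ} (hp : 0 ≤ p) : ((p - 1 / θ : ℝ) : EReal) ≤ betaMinus (V₀ + W) p := by
  obtain ⟨D, hD, hsub⟩ := exists_closedBall_subset_boundedEnergies hθ h
  have hA : ∀ᶠ N in atTop, Metric.closedBall E₀ (N ^ (-(1 / θ))) ⊆
      Set.Icc (-(|E₀| + 1)) (|E₀| + 1) ∩ boundedEnergies V₀ N (D * N ^ (0 : ℝ)) := by
    filter_upwards [eventually_ge_atTop 1] with N hN
    rw [Real.rpow_zero, mul_one]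
    exact hsub N hN
  have hvol : ∀ᶠ T : ℝ in atTop, ENNReal.ofReal (2 * T ^ (-(1 / θ))) ≤
      volume (energyNhd (fun N => Metric.closedBall E₀ (N ^ (-(1 / θ)))) 0 T) := by
    filter_upwards [eventually_ge_atTop 0] with T hT
    rw [← Real.volume_closedBall]
    exact measure_mono fun E hE => ⟨E, by simpa [scale] using hE, by simpa using hT⟩
  convert le_betaMinus_of_powerLaw hIci hIic hW hD le_rfl hA two_pos hvol hp using 2
  ring

theorem PowerLawBound.eventually_subset {V : S → ℝ} {K C α : ℝ} {A : ℝ → Set ℝ}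
    (h : PowerLawBound V K C α A) :
    ∀ᶠ N in atTop, A N ⊆ Set.Icc (-K) K ∩ boundedEnergies V N (C * N ^ α) :=
  h.mono fun _ hN _ hE => ⟨hN.2.2.1 hE, hN.2.2.2 _ hE⟩

end Exponents

end Schrodinger

theorem corollary3_general (S : Set ℤ) (hIci : Set.Ici 1 ⊆ S) (hIic : 0 ∈ S → Set.Iic 0 ⊆ S)
    (V₀ W : S → ℝ) (hW : (Function.support W).Finite) :
    (∀ K C α : ℝ, 0 < C → 0 ≤ α → ∀ A : ℝ → Set ℝ,
      (∀ᶠ N in atTop,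
        A N ⊆ Set.Icc (-K) K ∩ Schrodinger.boundedEnergies V₀ N (C * N ^ α)) →
      ∃ T₀ : ℝ, 1 < T₀ ∧
        (∃ c : ℝ, 0 < c ∧ ∀ T : ℝ, T₀ ≤ T →
          ENNReal.ofReal (c / T * Schrodinger.scale α T ^ (1 - 2 * α)) *
              volume (Schrodinger.energyNhd A α T) ≤
            Schrodinger.outsideProbability (V₀ + W) (Schrodinger.scale α T / 2) T) ∧
        (∀ p : ℝ, 0 < p → ∃ c : ℝ, 0 < c ∧ ∀ T : ℝ, T₀ ≤ T →
          ENNReal.ofReal (c / T * Schrodinger.scale α T ^ (p + 1 - 2 * α)) *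
              volume (Schrodinger.energyNhd A α T) ≤
            Schrodinger.moment (V₀ + W) p T)) ∧
    (∀ E₀ C α : ℝ, 0 ≤ α →
      (∀ n m : S, ((n : ℤ), (m : ℤ)) ≠ (0, 0) →
        ‖Schrodinger.transfer V₀ n m (E₀ : ℂ)‖ ≤
          C * (|((n : ℤ) : ℝ)| + |((m : ℤ) : ℝ)|) ^ α) →
      ∀ p : ℝ, 0 < p →
        (((p - 1 - 4 * α) / (1 + α) : ℝ) : EReal) ≤ Schrodinger.betaMinus (V₀ + W) p) ∧
    (∀ C E₀ θ : ℝ, 0 < θ →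
      (∀ (n : S) (E : ℝ), (n : ℤ) ≠ 0 → |((n : ℤ) : ℝ)| * |E - E₀| ^ θ ≤ 1 →
        ‖Schrodinger.transfer V₀ n 1 (E : ℂ)‖ ≤ C) →
      ∀ p : ℝ, 0 < p →
        ((p - 1 / θ : ℝ) : EReal) ≤ Schrodinger.betaMinus (V₀ + W) p) :=
  ⟨fun _ _ _ hC hα _ hA =>
      have ⟨T₀, hT₀, hout, hmoment⟩ :=
        Schrodinger.exists_lower_bounds_of_powerLaw hIci hIic hW hC hα hA
      ⟨T₀, hT₀, hout, fun p hp => hmoment p hp.le⟩,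
    fun _ _ _ hα h _ hp =>
      Schrodinger.le_betaMinus_of_norm_transfer_le_rpow hIci hIic hW hα h hp.le,
    fun _ _ _ hθ h _ hp =>
      Schrodinger.le_betaMinus_of_norm_transfer_one_le hIci hIic hW hθ h hp.le⟩

theorem corollary3 (S : Set ℤ) (hS : S = Set.univ ∨ S = Set.Ici 1)
    (V₀ W : S → ℝ) (hW : (Function.support W).Finite) :
    -- the power-law hypothesis for `V₀` gives the dynamical bounds for `V₀ + W`
    (∀ K C α : ℝ, 0 < K → 0 < C → 0 < α → ∀ A : ℝ → Set ℝ,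
      Schrodinger.PowerLawBound V₀ K C α A →
      ∃ T₀ : ℝ, 1 < T₀ ∧
        (∃ c : ℝ, 0 < c ∧ ∀ T : ℝ, T₀ ≤ T →
          ENNReal.ofReal (c / T * Schrodinger.scale α T ^ (1 - 2 * α)) *
              volume (Schrodinger.energyNhd A α T) ≤
            ∑' n : {n : S // Schrodinger.scale α T / 2 ≤ |((n : ℤ) : ℝ)|},
              Schrodinger.timeAverage (V₀ + W) n.1 T) ∧
        (∀ p : ℝ, 0 < p → ∃ c : ℝ, 0 < c ∧ ∀ T : ℝ, T₀ ≤ T →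
          ENNReal.ofReal (c / T * Schrodinger.scale α T ^ (p + 1 - 2 * α)) *
              volume (Schrodinger.energyNhd A α T) ≤
            Schrodinger.moment (V₀ + W) p T)) ∧
    -- the one-energy hypothesis for `V₀` gives the bound on the growth exponents for `V₀ + W`
    (∀ E₀ C α : ℝ, 0 ≤ α →
      (∀ n m : S, ((n : ℤ), (m : ℤ)) ≠ (0, 0) →
        ‖Schrodinger.transfer V₀ n m (E₀ : ℂ)‖ ≤
          C * (|((n : ℤ) : ℝ)| + |((m : ℤ) : ℝ)|) ^ α) →
      ∀ p : ℝ, 0 < p →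
        (((p - 1 - 4 * α) / (1 + α) : ℝ) : EReal) ≤ Schrodinger.betaMinus (V₀ + W) p) ∧
    -- bounded transfer matrices near one energy for `V₀`
    (∀ C E₀ θ : ℝ, 0 < C → 1 ≤ θ →
      (∀ (n : S) (E : ℝ), (n : ℤ) ≠ 0 → |((n : ℤ) : ℝ)| * |E - E₀| ^ θ ≤ 1 →
        ‖Schrodinger.transfer V₀ n 1 (E : ℂ)‖ ≤ C) →
      ∀ p : ℝ, 0 < p →
        ((p - 1 / θ : ℝ) : EReal) ≤ Schrodinger.betaMinus (V₀ + W) p) := by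
  obtain ⟨h1, h2, h3⟩ := corollary3_general S (by rcases hS with rfl | rfl <;> simp)
    (by rcases hS with rfl | rfl <;> simp) V₀ W hW
  exact ⟨fun K C α _ hC hα A hA => h1 K C α hC hα.le A hA.eventually_subset, h2,
    fun C E₀ θ _ hθ => h3 C E₀ θ (one_pos.trans_le hθ)⟩
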